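/- **Definitions.** Let $P\subset\mathbb R^d$ be a $d$-dimensional polytope, $V(P)$ its vertex set and $\operatorname{int}P$ its interior. The sphere $E(P)$ is obtained by stellarly subdividing every facet of $P$ and then, for each ridge $R$ of $P$, merging the two facets of the subdivision that contain $R$. Its proper cells are the following, where $(x,A)$ denotes the cell spanned by the face $x$ of $P$ and the new vertices on the facets in $A$, and the cells are ordered by componentwise inclusion: - $(x,\emptyset)$ for $x=\emptyset$ or $x$ a face of $P$ with $\dim x\le d-3$; - $(x,\{F\})$ for a facet $F$ of $P$ and $x=\emptyset$ or $x\subset F$ a face with $\dim x\le d-3$; - $(R,\{F,F'\})$ for a non-empty ridge $R=F\cap F'$ of $P$ with adjacent facets $F,F'$. For a segment ($d=1$), $E(P)$ is thus a segment whose end points are the two new vertices; for a point ($d=0$) we put $E(P)=P$. A point lies *beyond* a facet $F$ of $P$ if it lies strictly on the side of the hyperplane spanned by $F$ that does not contain $P$. A *vertex-preserving realisation* of $E(P)$ is a polytope $Q=\operatorname{conv}(P\cup\{p_F: F \text{ a facet of } P\})$, with $p_F$ a point beyond $F$ for each facet $F$, such that $(x,A)\mapsto\operatorname{conv}(x\cup\{p_F:F\in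 A\})$ is an isomorphism from the poset of proper cells of $E(P)$ onto the poset of proper faces of $Q$ (including $\emptyset$). (So for $d=2$ the vertices of $P$ lie on the edges of $Q$, and for $d=1$ $Q$ is a segment containing $P$ in its interior.) **Theorem.** Let $P_0\subset\mathbb R^{d_0}$ and $P_1\subset\mathbb R^{d_1}$ be polytopes of dimensions $d_0$ and $d_1$ with $\dim(P_0\times P_1)=d_0+d_1\ge 3$. Consider the following conditions. (A) There exist vertex-preserving realisations $Q_0$ of $E(P_0)$ and $Q_1$ of $E(P_1)$. (B) With $T_i:=V(Q_i)\setminus V(P_i)$, there are maps $\beta_0:T_0\to\operatorname{int}P_1$ and $\beta_1:T_1\to\operatorname{int}P_0$ such that for every $(v_0,v_1)\in T_0\times T_1$ the fraction of the segment from $v_0$ to $\beta_1(v_1)$ that lies outside $P_0$ equals the fraction of the segment from $v_1$ to $\beta_0(v_0)$ that lies inside $P_1$. 1. For all $Q_0,Q_1$ as in (A) and all $\beta_0,\beta_1$ as in (B), let $S\subset\mathbb R^{d_0}\times\mathbb R^{d_1}$ consist of all pairs $(p_0,p_1)$ with $p_i\in V(P_i)$, all pairs $(v_0,\beta_0(v_0))$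 with $v_0\in T_0$, and all pairs $(\beta_1(v_1),v_1)$ with $v_1\in T_1$. Then $\operatorname{conv}(S)$ is a vertex-preserving realisation of $E(P_0\times P_1)$. 2. A vertex-preserving realisation of $E(P_0\times P_1)$ exists if and only if there are $Q_0,Q_1$ as in (A) for which there are maps $\beta_0,\beta_1$ as in (B). -/

import Mathlib

open Set

noncomputable section

namespace EConstruction

variable {E : Type*} [NormedAddCommGroup E] [NormedSpace ℝ E]

/-- A full-dimensional polytope: the convex hull of a finite set, with non-empty interior. -/
def IsFullPolytope (P : Set E) : Prop :=
  (∃ s : Set E, s.Finite ∧ P = convexHull ℝ s) ∧ (interior P).Nonempty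

/-- Dimension of the affine hull (used for non-empty sets; the value at `∅` is never relied on). -/
def dim (S : Set E) : ℕ := Module.finrank ℝ (vectorSpan ℝ S)

/-- The face lattice of a polytope, ordered by inclusion. `IsExposed ℝ P F` says that `F` is the
set of maximisers on `P` of a linear functional, or empty; so `∅` and `P` are faces. -/
abbrev Face (P : Set E) : Type _ := {F : Set E // IsExposed ℝ P F}

/-- The facets: non-empty faces of codimension one. -/
abbrev Facet (P : Set E) : Type _ :=
  {F : Set E // IsExposed ℝ P F ∧ F.Nonempty ∧ dim F + 1 = dim P}

/-- The ridges: non-empty faces of codimension two. -/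
def IsRidge (P R : Set E) : Prop := IsExposed ℝ P R ∧ R.Nonempty ∧ dim R + 2 = dim P

/-- The faces of codimension at least three, and the empty face. -/
def IsLow (P x : Set E) : Prop := x = ∅ ∨ dim x + 3 ≤ dim P

/-- The face poset of the sphere `E(P)`, with a top element added. The pair `(x, A)` of a face `x`
of `P` and a set `A` of facets stands for the cell spanned by `x` and the new vertices placed on
the facets in `A`; the order is componentwise inclusion.

Subdividing all facets of `P` stellarly gives the cells `(x, ∅)` for faces `x` of codimension at
least two and `(x, {F})` for proper faces `x` of a facet `F`. Merging the two maximal cells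
`(R, {F})` and `(R, {F'})` that share a ridge `R = F ∩ F'` of `P` deletes `(R, {F})`, `(R, {F'})`
and `(R, ∅)` and creates `(R, {F, F'})`. What remains is listed below. For a polygon, the vertices
of `P` have become ridges and lie on the new edges; for a segment, the result is a segment whose
two end points are the new vertices; for a point, it is the point itself. -/
def EPoset (P : Set E) : Set (Face P × Set (Facet P)) :=
  {c | (IsLow P c.1.1 ∧ c.2 = ∅) ∨
       (∃ F : Facet P, IsLow P c.1.1 ∧ c.1.1 ⊆ F.1 ∧ c.2 = {F}) ∨
       (IsRidge P c.1.1 ∧ c.2 = {F : Facet P | c.1.1 ⊆ F.1}) ∨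
       (c.1.1 = P ∧ c.2 = Set.univ)}

/-- The point `p` lies beyond the facet `F` of `P`: strictly on the side of the hyperplane spanned
by `F` that does not contain `P`. -/
def IsBeyond (P F : Set E) (p : E) : Prop :=
  ∃ (l : E →L[ℝ] ℝ) (c : ℝ), (∀ x ∈ P, l x ≤ c) ∧ (∀ x ∈ F, l x = c) ∧ c < l p

/-- `Q` is a vertex-preserving realisation of `E(P)`: it is the convex hull of `P` and of one new
point `p F` beyond each facet `F` of `P`, and its face lattice is that of `E(P)`, where the cell
`(x, A)` is realised as the face spanned by `x` and the points `p F`, `F ∈ A`. -/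
def IsVertexPreservingRealisation (P Q : Set E) : Prop :=
  ∃ p : Facet P → E,
    (∀ F : Facet P, IsBeyond P F.1 (p F)) ∧
    Q = convexHull ℝ (P ∪ Set.range p) ∧
    ∃ Φ : EPoset P ≃o Face Q,
      ∀ c : EPoset P, (Φ c).1 = convexHull ℝ (c.1.1.1 ∪ p '' c.1.2)

/-- The new vertices `V(Q) \ V(P)`. -/
def newVertices (P Q : Set E) : Set E := Q.extremePoints ℝ \ P.extremePoints ℝ

/-- The fraction of the segment from `a` to `b` inside `P`. -/
def fractionInside (P : Set E) (a b : E) : ℝ :=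
  (MeasureTheory.volume {t : ℝ | t ∈ Set.Icc (0 : ℝ) 1 ∧ AffineMap.lineMap a b t ∈ P}).toReal

/-- The fraction of the segment from `a` to `b` outside `P`. -/
def fractionOutside (P : Set E) (a b : E) : ℝ :=
  (MeasureTheory.volume {t : ℝ | t ∈ Set.Icc (0 : ℝ) 1 ∧ AffineMap.lineMap a b t ∉ P}).toReal

variable {E₀ E₁ : Type*} [NormedAddCommGroup E₀] [NormedSpace ℝ E₀]
  [NormedAddCommGroup E₁] [NormedSpace ℝ E₁]

/-- The ratio condition on a pair of maps from the new vertices of one factor into the interior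
of the other factor. -/
def RatioCondition (P₀ Q₀ : Set E₀) (P₁ Q₁ : Set E₁)
    (β₀ : newVertices P₀ Q₀ → interior P₁) (β₁ : newVertices P₁ Q₁ → interior P₀) : Prop :=
  ∀ (v₀ : newVertices P₀ Q₀) (v₁ : newVertices P₁ Q₁),
    fractionOutside P₀ (v₀ : E₀) (β₁ v₁ : E₀) = fractionInside P₁ (v₁ : E₁) (β₀ v₀ : E₁)

/-- The vertices of the product, and the points `(v₀, β₀ v₀)` and `(β₁ v₁, v₁)`. -/
def productPoints (P₀ Q₀ : Set E₀) (P₁ Q₁ : Set E₁)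
    (β₀ : newVertices P₀ Q₀ → interior P₁) (β₁ : newVertices P₁ Q₁ → interior P₀) :
    Set (E₀ × E₁) :=
  (P₀.extremePoints ℝ ×ˢ P₁.extremePoints ℝ) ∪
    Set.range (fun v₀ : newVertices P₀ Q₀ => ((v₀ : E₀), (β₀ v₀ : E₁))) ∪
    Set.range (fun v₁ : newVertices P₁ Q₁ => ((β₁ v₁ : E₀), (v₁ : E₁)))

end EConstruction

end

/-! The idea is to replace the combinatorial notion of realisation by a local linear one. Fix `o` in
the interior of `P` and write the hyperplane of a facet `F` as `k (x - o) = 1`, where `k` is an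
extreme point `facetFn o F` of the polar body. A family of points `p F` beyond the facets is flat
(`IsFlat`) if, for every ridge `R = F ∩ G`, the set `R` and the points `p F`, `p G` lie on one
supporting hyperplane of `P`. Vertex-preserving realisations are exactly the polytopes spanned by
flat families (`isVertexPreservingRealisation_iff`).

A realisation is flat because the cell of a ridge is a proper face of `Q`, so some hyperplane
supports `Q` along it. Conversely, flatness puts `p F` strictly beneath each facet adjacent to `F`.
Since a facet is cut out of its hyperplane by its neighbours (`mem_facet_of_adjacent`), `p F` is
then strictly beneath all other facets (`facetFn_lt_one_of_ne`). Hence the ridge hyperplanes support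
`Q`, and in dimension at least two they cut it out (`mem_convexHull_of_ridgeFn_le`). The cells are
the intersections of the faces on these hyperplanes, and every proper face is a cell
(`isExposed_convexHull_cell`, `exists_cell_eq`). Dimensions zero and one have no ridges and are
treated by hand.

For a product, flatness is checked ridge by ridge (`isFlat_prod_iff`). Ridges `R × P₁` and `P₀ × R`
say that the coordinates in the factors form flat families. For a ridge `F × G`, a common hyperplane
amounts to two linear equations in one weight `t ∈ (0, 1)`. They are solvable exactly when two facet
values are less than one and two quotients agree (`exists_comb_iff`). Over all pairs, the
inequalities say that the complementary coordinates are interior points. The quotients are the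
fractions of segments in the ratio condition, because a new vertex violates only one facet
inequality. -/

noncomputable section

namespace EConstruction

/-! ### Polar bodies, faces as sets of tight points, generic points of faces -/

section Polar

variable {E : Type*} [NormedAddCommGroup E] [NormedSpace ℝ E]

/-- The polar body of `P` with respect to the origin `o`. -/
def polarAt (P : Set E) (o : E) : Set (E →L[ℝ] ℝ) := {k | ∀ x ∈ P, k (x - o) ≤ 1}

/-- The face of `P` on which the functional `k` of the polar body attains the value one. -/
def touch (P : Set E) (o : E) (k : E →L[ℝ] ℝ) : Set E := {x ∈ P | k (x - o) = 1}

/-- The linear span of a set seen from the origin `o`. -/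
def relSpan (o : E) (F : Set E) : Submodule ℝ E := Submodule.span ℝ ((fun x => x - o) '' F)

variable {P F : Set E} {o : E} {k : E →L[ℝ] ℝ}

theorem sub_mem_relSpan {x : E} (hx : x ∈ F) : x - o ∈ relSpan o F :=
  Submodule.subset_span ⟨x, hx, rfl⟩

theorem relSpan_le_ker {h : E →L[ℝ] ℝ} (hh : ∀ x ∈ F, h (x - o) = 0) {v : E}
    (hv : v ∈ relSpan o F) : h v = 0 := by
  have : relSpan o F ≤ LinearMap.ker (h : E →ₗ[ℝ] ℝ) := by
    refine Submodule.span_le.2 ?_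
    rintro _ ⟨x, hx, rfl⟩
    exact hh x hx
  exact this hv

theorem eq_on_relSpan {h h' : E →L[ℝ] ℝ} (hh : ∀ x ∈ F, h (x - o) = h' (x - o)) {v : E}
    (hv : v ∈ relSpan o F) : h v = h' v := by
  have := relSpan_le_ker (h := h - h') (fun x hx => by simp [hh x hx]) hv
  simpa [sub_eq_zero] using this

theorem polarAt_convex : Convex ℝ (polarAt P o) := by
  intro k hk l hl a b ha hb hab x hx
  have h1 := hk x hx
  have h2 := hl x hx
  simp only [add_apply, smul_apply, smul_eq_mul]
  nlinarith

theorem polarAt_isClosed : IsClosed (polarAt P o) := by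
  have : polarAt P o = ⋂ x ∈ P, {k : E →L[ℝ] ℝ | k (x - o) ≤ 1} := by
    ext k; simp [polarAt]
  rw [this]
  refine isClosed_biInter fun x _ => isClosed_le ?_ continuous_const
  fun_prop

theorem polarAt_isBounded (ho : o ∈ interior P) : Bornology.IsBounded (polarAt P o) := by
  rw [mem_interior_iff_mem_nhds, Metric.mem_nhds_iff] at ho
  obtain ⟨r, hr, hP⟩ := ho
  rw [isBounded_iff_forall_norm_le]
  refine ⟨2 / r, fun k hk => ?_⟩
  have key : ∀ v : E, ‖v‖ < r → k v ≤ 1 := by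
    intro v hv
    have := hk (o + v) (hP (by simpa using hv))
    simpa using this
  refine ContinuousLinearMap.opNorm_le_of_shell (f := k) hr (by positivity) (c := 2) (by simp) ?_
  intro x hx1 hx2
  simp only [Real.norm_eq_abs, Nat.abs_ofNat] at hx1
  have h1 := key x hx2
  have h2 := key (-x) (by simpa using hx2)
  rw [map_neg] at h2
  rw [Real.norm_eq_abs]
  have : |k x| ≤ 1 := abs_le.2 ⟨by linarith, h1⟩
  refine this.trans ?_
  calc (1 : ℝ) = 2 / r * (r / 2) := by field_simp
    _ ≤ 2 / r * ‖x‖ := by gcongr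

theorem polarAt_isCompact [FiniteDimensional ℝ E] (ho : o ∈ interior P) :
    IsCompact (polarAt P o) := by
  have : ProperSpace (E →L[ℝ] ℝ) := FiniteDimensional.proper ℝ _
  exact Metric.isCompact_of_isClosed_isBounded polarAt_isClosed (polarAt_isBounded ho)

theorem touch_isExposed (hk : k ∈ polarAt P o) : IsExposed ℝ P (touch P o k) := by
  rintro ⟨x0, hx0, h0⟩
  refine ⟨k, ?_⟩
  ext x
  constructor
  · rintro ⟨hx, h⟩
    refine ⟨hx, fun y hy => ?_⟩
    have := hk y hy
    simp only [map_sub] at this h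
    linarith
  · rintro ⟨hx, h⟩
    refine ⟨hx, le_antisymm (hk x hx) ?_⟩
    have := h x0 hx0
    simp only [map_sub] at this h0 ⊢
    linarith

/-- From an interior point one can move a little in a direction that increases `l`; the direction `l
v • v` does so whatever the sign of `l v`. -/
theorem apply_sub_lt_of_mem_interior {l : E →L[ℝ] ℝ} (hl : l ≠ 0) {c : ℝ}
    (hc : ∀ x ∈ P, l x ≤ c) {x : E} (hx : x ∈ interior P) : l x < c := by
  obtain ⟨v, hv⟩ : ∃ v, l v ≠ 0 := by
    by_contra! h
    exact hl (ContinuousLinearMap.ext h)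
  have hcont : Filter.Tendsto (fun t : ℝ => x + t • (l v • v)) (nhds 0) (nhds x) := by
    have : Continuous (fun t : ℝ => x + t • (l v • v)) := by fun_prop
    simpa using this.tendsto 0
  have h1 := hcont.eventually (mem_interior_iff_mem_nhds.1 hx)
  have h2 : ∀ᶠ t : ℝ in nhdsWithin 0 (Ioi 0), x + t • (l v • v) ∈ P := h1.filter_mono nhdsWithin_le_nhds
  obtain ⟨t, ht, ht0⟩ := (h2.and self_mem_nhdsWithin).exists
  have h3 := hc _ ht
  simp only [map_add, map_smul, smul_eq_mul] at h3
  have : 0 < t * (l v * l v) := mul_pos ht0 (mul_self_pos.2 hv)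
  linarith

theorem lt_one_of_mem_interior (hk : k ∈ polarAt P o) {x : E} (hx : x ∈ interior P) :
    k (x - o) < 1 := by
  by_cases h : k = 0
  · simp [h]
  · have := apply_sub_lt_of_mem_interior h (c := 1 + k o) (fun y hy => by
      have := hk y hy
      simp only [map_sub] at this
      linarith) hx
    simp only [map_sub]
    linarith

/-- A valid inequality that is tight somewhere can be normalised with respect to `o`. -/
theorem exists_polarAt_of_le (ho : o ∈ interior P) {l : E →L[ℝ] ℝ} (hl : l ≠ 0) {c : ℝ}
    (hc : ∀ x ∈ P, l x ≤ c) :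
    0 < c - l o ∧ (c - l o)⁻¹ • l ∈ polarAt P o ∧
      ∀ x, ((c - l o)⁻¹ • l) (x - o) = 1 ↔ l x = c := by
  have h0 : 0 < c - l o := by
    have := apply_sub_lt_of_mem_interior hl hc ho
    linarith
  refine ⟨h0, fun x hx => ?_, fun x => ?_⟩
  · rw [smul_apply, map_sub, smul_eq_mul]
    rw [inv_mul_le_iff₀ h0]
    have := hc x hx
    linarith
  · rw [smul_apply, map_sub, smul_eq_mul]
    rw [inv_mul_eq_iff_eq_mul₀ h0.ne']
    constructor <;> intro h <;> linarith

/-- Since the face is proper, its functional is non-zero, so its maximum exceeds the value at `o`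
and can be normalised to one. -/
theorem exists_touch_of_isExposed (ho : o ∈ interior P) (hF : IsExposed ℝ P F)
    (hne : F.Nonempty) (hFP : F ≠ P) : ∃ k ∈ polarAt P o, F = touch P o k := by
  obtain ⟨l, hl⟩ := hF hne
  obtain ⟨x0, hx0⟩ := hne
  have hx0' : x0 ∈ P ∧ ∀ y ∈ P, l y ≤ l x0 := by rw [hl] at hx0; exact hx0
  have hl0 : l ≠ 0 := by
    rintro rfl
    apply hFP
    rw [hl]; ext x; simp
  obtain ⟨-, h2, h3⟩ := exists_polarAt_of_le ho hl0 hx0'.2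
  refine ⟨_, h2, ?_⟩
  rw [hl]
  ext x
  constructor
  · rintro ⟨hx, h⟩
    exact ⟨hx, (h3 x).2 (le_antisymm (hx0'.2 x hx) (h x0 hx0'.1))⟩
  · rintro ⟨hx, h⟩
    rw [h3] at h
    exact ⟨hx, fun y hy => h ▸ hx0'.2 y hy⟩

/-- The functional `k` is one on `F` and zero on the directions of `F`, so the line through `x0 - o`
is complementary to the direction space in the span. This turns affine dimensions into ranks. -/
theorem finrank_relSpan [FiniteDimensional ℝ E] (hne : F.Nonempty)
    (hk : ∀ x ∈ F, k (x - o) = 1) : Module.finrank ℝ (relSpan o F) = dim F + 1 := by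
  obtain ⟨x0, hx0⟩ := hne
  have hkv : ∀ v ∈ vectorSpan ℝ F, k v = 0 := by
    intro v hv
    have : vectorSpan ℝ F ≤ LinearMap.ker (k : E →ₗ[ℝ] ℝ) := by
      rw [vectorSpan_def, Submodule.span_le]
      rintro _ ⟨x, hx, y, hy, rfl⟩
      have h1 := hk x hx
      have h2 := hk y hy
      simp only [map_sub] at h1 h2
      simp only [vsub_eq_sub, SetLike.mem_coe, LinearMap.mem_ker, ContinuousLinearMap.coe_coe, map_sub]
      linarith
    exact this hv
  have hsup : relSpan o F = vectorSpan ℝ F ⊔ Submodule.span ℝ {x0 - o} := by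
    apply le_antisymm
    · refine Submodule.span_le.2 ?_
      rintro _ ⟨x, hx, rfl⟩
      have : x - o = (x - x0) + (x0 - o) := by abel
      simp only [SetLike.mem_coe]
      rw [this]
      exact Submodule.add_mem_sup (vsub_mem_vectorSpan ℝ hx hx0) (Submodule.mem_span_singleton_self _)
    · refine sup_le ?_ ?_
      · rw [vectorSpan_def, Submodule.span_le]
        rintro _ ⟨x, hx, y, hy, rfl⟩
        have : x -ᵥ y = (x - o) - (y - o) := by simp
        simp only [SetLike.mem_coe, this]
        exact Submodule.sub_mem _ (sub_mem_relSpan hx) (sub_mem_relSpan hy)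
      · rw [Submodule.span_singleton_le_iff_mem]
        exact sub_mem_relSpan hx0
  have hx00 : x0 - o ≠ 0 := by
    intro h
    have := hk x0 hx0
    simp [h] at this
  have hdisj : vectorSpan ℝ F ⊓ Submodule.span ℝ {x0 - o} = ⊥ := by
    rw [eq_bot_iff]
    rintro v ⟨hv1, hv2⟩
    obtain ⟨a, rfl⟩ := Submodule.mem_span_singleton.1 hv2
    have := hkv _ hv1
    rw [map_smul, hk x0 hx0] at this
    simp at this
    simp [this]
  have := Submodule.finrank_sup_add_finrank_inf_eq (vectorSpan ℝ F) (Submodule.span ℝ {x0 - o})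
  rw [hdisj, finrank_bot, finrank_span_singleton hx00, ← hsup] at this
  simpa [dim] using this

theorem relSpan_mono {G : Set E} (h : F ⊆ G) : relSpan o F ≤ relSpan o G :=
  Submodule.span_mono (image_mono h)

theorem dim_eq_finrank [FiniteDimensional ℝ E] (hP : (interior P).Nonempty) :
    dim P = Module.finrank ℝ E := by
  have h := affineSpan_eq_top_of_nonempty_interior (s := P)
    (hP.mono (interior_mono (subset_convexHull ℝ P)))
  have h2 : vectorSpan ℝ P = ⊤ := by
    rw [← direction_affineSpan, h, AffineSubspace.direction_top]
  rw [dim, h2, finrank_top]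

/-- A finite set of points has a point in its convex hull at which every valid linear inequality
that is tight is tight on the whole set. -/
theorem exists_generic_mem_convexHull {T : Set E} (hT : T.Finite) (hne : T.Nonempty) :
    ∃ z ∈ convexHull ℝ T, ∀ (k : E →L[ℝ] ℝ) (c : ℝ), (∀ x ∈ T, k x ≤ c) → k z = c →
      ∀ x ∈ T, k x = c := by
  lift T to Finset E using hT
  have hne' : T.Nonempty := by simpa using hne
  refine ⟨T.centroid ℝ id, ?_, ?_⟩
  · have := T.centroid_mem_convexHull (R := ℝ) hne'
    simpa using this
  intro k c hle hz x hx
  have hcard : (0 : ℝ) < T.card := by exact_mod_cast hne'.card_pos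
  have hcen : (T.card : ℝ) • T.centroid ℝ id = ∑ x ∈ T, x := by
    rw [Finset.centroid_def, Finset.affineCombination_eq_linear_combination]
    · simp only [Finset.centroidWeights_apply, id]
      rw [← Finset.smul_sum, smul_smul, mul_inv_cancel₀ hcard.ne', one_smul]
    · exact Finset.sum_centroidWeights_eq_one_of_nonempty ℝ T hne'
  have h1 := congrArg k hcen
  rw [map_smul, hz, map_sum, smul_eq_mul] at h1
  have h2 : ∑ x ∈ T, (c - k x) = 0 := by
    rw [Finset.sum_sub_distrib, ← h1]; simp
  rw [Finset.sum_eq_zero_iff_of_nonneg (fun x hx => sub_nonneg.2 (hle x hx))] at h2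
  have := h2 x hx
  linarith

/-- A face of a convex hull is the convex hull of the generators it contains. -/
theorem convexHull_inter_of_le {T : Set E} {l : E →L[ℝ] ℝ} {c : ℝ} (hc : ∀ x ∈ T, l x ≤ c) :
    {x ∈ convexHull ℝ T | l x = c} = convexHull ℝ {x ∈ T | l x = c} := by
  apply Subset.antisymm
  · have key : convexHull ℝ T ⊆ {x | l x ≤ c ∧ (l x = c → x ∈ convexHull ℝ {x ∈ T | l x = c})} := by
      refine convexHull_min (fun x hx => ⟨hc x hx, fun h => subset_convexHull ℝ _ ⟨hx, h⟩⟩) ?_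
      rintro x ⟨hx1, hx2⟩ y ⟨hy1, hy2⟩ a b ha hb hab
      simp only [mem_ofPred_eq, map_add, map_smul, smul_eq_mul]
      have hc' : a * c + b * c = c := by rw [← add_mul, hab, one_mul]
      have ha1 := mul_le_mul_of_nonneg_left hx1 ha
      have hb1 := mul_le_mul_of_nonneg_left hy1 hb
      refine ⟨by linarith, fun h => ?_⟩
      rcases ha.eq_or_lt with rfl | ha'
      · simp only [zero_add] at hab
        subst hab
        simpa using hy2 (by simpa using h)
      rcases hb.eq_or_lt with rfl | hb'
      · simp only [add_zero] at hab
        subst hab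
        simpa using hx2 (by simpa using h)
      have e1 : l x = c := by
        by_contra hne
        have : l x < c := lt_of_le_of_ne hx1 hne
        have : a * l x < a * c := mul_lt_mul_of_pos_left this ha'
        linarith
      have e2 : l y = c := by
        by_contra hne
        have : l y < c := lt_of_le_of_ne hy1 hne
        have : b * l y < b * c := mul_lt_mul_of_pos_left this hb'
        linarith
      exact convex_convexHull ℝ _ (hx2 e1) (hy2 e2) ha hb hab
    exact fun x hx => (key hx.1).2 hx.2
  · refine convexHull_min (fun x hx => ⟨subset_convexHull ℝ _ hx.1, hx.2⟩) ?_
    rintro x ⟨hx, hx'⟩ y ⟨hy, hy'⟩ a b ha hb hab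
    refine ⟨convex_convexHull ℝ T hx hy ha hb hab, ?_⟩
    rw [map_add, map_smul, map_smul, hx', hy', smul_eq_mul, smul_eq_mul, ← add_mul, hab, one_mul]

theorem le_of_mem_convexHull {T : Set E} {l : E →L[ℝ] ℝ} {c : ℝ} (hc : ∀ x ∈ T, l x ≤ c) {x : E}
    (hx : x ∈ convexHull ℝ T) : l x ≤ c :=
  convexHull_min (t := {x | l x ≤ c}) hc (convex_halfSpace_le l.isBoundedLinearMap.toIsLinearMap c) hx

theorem exposed_eq_convexHull {T B : Set E} (hB : IsExposed ℝ (convexHull ℝ T) B) :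
    B = convexHull ℝ (B ∩ T) := by
  rcases B.eq_empty_or_nonempty with rfl | hne
  · simp
  obtain ⟨l, hl⟩ := hB hne
  obtain ⟨x0, hx0⟩ := hne
  have hx0' := hx0
  rw [hl] at hx0'
  have hc : ∀ x ∈ T, l x ≤ l x0 := fun x hx => hx0'.2 x (subset_convexHull ℝ _ hx)
  have hB2 : B = {x ∈ convexHull ℝ T | l x = l x0} := by
    rw [hl]; ext x
    exact ⟨fun h => ⟨h.1, le_antisymm (le_of_mem_convexHull hc h.1) (h.2 x0 hx0'.1)⟩,
      fun h => ⟨h.1, fun y hy => h.2 ▸ le_of_mem_convexHull hc hy⟩⟩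
  have := convexHull_inter_of_le hc
  rw [← hB2] at this
  conv_lhs => rw [this]
  congr 1
  ext x
  rw [hB2]
  exact ⟨fun h => ⟨⟨subset_convexHull ℝ _ h.1, h.2⟩, h.1⟩, fun h => ⟨h.2, h.1.2⟩⟩

end Polar

/-! ### Facets as extreme points of the polar body -/

section Facets

variable {E : Type*} [NormedAddCommGroup E] [NormedSpace ℝ E]

theorem IsFullPolytope.convex {P : Set E} (hP : IsFullPolytope P) : Convex ℝ P := by
  obtain ⟨⟨s, -, rfl⟩, -⟩ := hP
  exact convex_convexHull ℝ s

theorem IsFullPolytope.isCompact {P : Set E} (hP : IsFullPolytope P) : IsCompact P := by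
  obtain ⟨⟨s, hs, rfl⟩, -⟩ := hP
  exact hs.isCompact_convexHull ℝ

theorem IsFullPolytope.finite_faces {P : Set E} (hP : IsFullPolytope P) :
    {F : Set E | IsExposed ℝ P F}.Finite := by
  obtain ⟨⟨s, hs, rfl⟩, -⟩ := hP
  refine (hs.powerset.image (convexHull ℝ)).subset ?_
  intro F hF
  exact ⟨F ∩ s, inter_subset_right, (exposed_eq_convexHull hF).symm⟩

theorem IsFullPolytope.finite_facet {P : Set E} (hP : IsFullPolytope P) : Finite (Facet P) :=
  (hP.finite_faces.subset fun _ hF => hF.1).to_subtype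

/-- Plays the role of a relative interior point; the centroid of the generators lying in `F` serves.
-/
theorem IsFullPolytope.exists_generic {P : Set E} (hP : IsFullPolytope P) {F : Set E}
    (hF : IsExposed ℝ P F) (hne : F.Nonempty) :
    ∃ z ∈ F, ∀ (k : E →L[ℝ] ℝ) (c : ℝ), (∀ x ∈ F, k x ≤ c) → k z = c → ∀ x ∈ F, k x = c := by
  obtain ⟨⟨s, hs, rfl⟩, -⟩ := hP
  have h := exposed_eq_convexHull hF
  have hne' : (F ∩ s).Nonempty := by
    rw [h] at hne
    exact convexHull_nonempty_iff.1 hne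
  obtain ⟨z, hz, hz2⟩ := exists_generic_mem_convexHull (hs.subset inter_subset_right) hne'
  rw [← h] at hz
  refine ⟨z, hz, fun k c hk hkz x hx => ?_⟩
  have h1 := hz2 k c (fun x hx => hk x hx.1) hkz
  rw [h] at hx
  refine le_antisymm (le_of_mem_convexHull (fun x hx => (h1 x hx).le) hx) ?_
  have := le_of_mem_convexHull (l := -k) (c := -c) (fun x hx => by simp [h1 x hx]) hx
  simpa using this

theorem exists_dual_ne_zero [FiniteDimensional ℝ E] {W : Submodule ℝ E} (hW : W ≠ ⊤) :
    ∃ h : E →L[ℝ] ℝ, h ≠ 0 ∧ ∀ v ∈ W, h v = 0 := by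
  obtain ⟨f, hf, hle⟩ := Submodule.exists_le_ker_of_lt_top W (lt_top_iff_ne_top.2 hW)
  refine ⟨LinearMap.toContinuousLinearMap f, ?_, fun v hv => by simpa using hle hv⟩
  simpa using hf

/-- Evaluation at `v` attains its maximum on a compact exposed face of `C`, which has an extreme
point by Krein–Milman. -/
theorem exists_extremePoint_ge [FiniteDimensional ℝ E] {C : Set (E →L[ℝ] ℝ)} (hC : IsCompact C)
    {k : E →L[ℝ] ℝ} (hk : k ∈ C) (v : E) : ∃ e ∈ C.extremePoints ℝ, k v ≤ e v := by
  let ev : StrongDual ℝ (E →L[ℝ] ℝ) := ContinuousLinearMap.apply ℝ ℝ v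
  have hexp : IsExposed ℝ C (ev.toExposed C) := ContinuousLinearMap.toExposed.isExposed
  have hcpt := hexp.isCompact hC
  obtain ⟨m, hm, hmax⟩ := hC.exists_isMaxOn ⟨k, hk⟩ ev.continuous.continuousOn
  have hne : (ev.toExposed C).Nonempty := ⟨m, hm, fun y hy => hmax hy⟩
  obtain ⟨e, he⟩ := hcpt.extremePoints_nonempty hne
  exact ⟨e, hexp.isExtreme.extremePoints_subset_extremePoints he, (extremePoints_subset he).2 k hk⟩

variable {P F : Set E} {o : E} {k : E →L[ℝ] ℝ}

/-- Only the finitely many generators have to be tested: tight ones are not affected by `h`, and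
slack ones stay slack for small `ε`. -/
theorem eventually_mem_polarAt (hP : IsFullPolytope P) (hk : k ∈ polarAt P o) {h : E →L[ℝ] ℝ}
    (hh : ∀ x ∈ touch P o k, h (x - o) = 0) :
    ∀ᶠ ε in nhds (0 : ℝ), k + ε • h ∈ polarAt P o := by
  obtain ⟨⟨s, hs, rfl⟩, -⟩ := hP
  have : ∀ᶠ ε in nhds (0 : ℝ), ∀ v ∈ s, (k + ε • h) (v - o) ≤ 1 := by
    rw [Filter.eventually_all_finite hs]
    intro v hv
    have hvP : v ∈ convexHull ℝ s := subset_convexHull ℝ s hv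
    rcases (hk v hvP).eq_or_lt with h1 | h1
    · refine Filter.Eventually.of_forall fun ε => ?_
      rw [add_apply, smul_apply, hh v ⟨hvP, h1⟩, h1]
      simp
    · have hc : Continuous (fun ε : ℝ => (k + ε • h) (v - o)) := by
        simp only [add_apply, smul_apply]
        fun_prop
      have := hc.tendsto 0
      simp only [zero_smul, add_zero] at this
      exact (this.eventually (gt_mem_nhds h1)).mono fun _ h => h.le
  filter_upwards [this] with ε hε x hx
  have := le_of_mem_convexHull (l := k + ε • h) (c := 1 + (k + ε • h) o)
    (fun x hx => by have := hε x hx; rw [map_sub] at this; linarith) hx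
  rw [map_sub]
  linarith

theorem exists_ne_zero_perturbation (hP : IsFullPolytope P) (hk : k ∈ polarAt P o) {h : E →L[ℝ] ℝ}
    (hh : ∀ x ∈ touch P o k, h (x - o) = 0) :
    ∃ ε : ℝ, ε ≠ 0 ∧ k + ε • h ∈ polarAt P o ∧ k + (-ε) • h ∈ polarAt P o := by
  have h1 := eventually_mem_polarAt hP hk hh
  have h2 : ∀ᶠ ε in nhds (0 : ℝ), k + (-ε) • h ∈ polarAt P o := by
    have : Filter.Tendsto (fun ε : ℝ => -ε) (nhds 0) (nhds 0) := by
      simpa using (continuous_neg (G := ℝ)).tendsto 0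
    exact this.eventually h1
  have h3 : ∀ᶠ ε in nhdsWithin (0 : ℝ) {0}ᶜ, k + ε • h ∈ polarAt P o ∧ k + (-ε) • h ∈ polarAt P o :=
    (h1.and h2).filter_mono nhdsWithin_le_nhds
  obtain ⟨ε, hε, hε0⟩ := (h3.and self_mem_nhdsWithin).exists
  exact ⟨ε, hε0, hε⟩

theorem mem_openSegment_perturbation {V : Type*} [AddCommGroup V] [Module ℝ V] (k h : V) (ε : ℝ) :
    k ∈ openSegment ℝ (k + ε • h) (k + (-ε) • h) :=
  ⟨1 / 2, 1 / 2, by norm_num, by norm_num, by norm_num, by module⟩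

/-- If the tight points did not span, a functional vanishing on them could be added and subtracted,
making `k` an interior point of a segment in the polar body. -/
theorem relSpan_touch_eq_top [FiniteDimensional ℝ E] (hP : IsFullPolytope P)
    (hk : k ∈ (polarAt P o).extremePoints ℝ) : relSpan o (touch P o k) = ⊤ := by
  by_contra hW
  obtain ⟨h, h0, hh⟩ := exists_dual_ne_zero hW
  obtain ⟨ε, hε, h1, h2⟩ := exists_ne_zero_perturbation hP hk.1
    (fun x hx => hh _ (sub_mem_relSpan hx))
  have := hk.2 h1 h2 (mem_openSegment_perturbation k h ε)
  simp [hε, h0] at this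

theorem eq_of_relSpan_eq_top (h : relSpan o F = ⊤) {k' : E →L[ℝ] ℝ}
    (hk : ∀ x ∈ F, k (x - o) = 1) (hk' : ∀ x ∈ F, k' (x - o) = 1) : k = k' := by
  ext v
  exact eq_on_relSpan (F := F) (o := o) (fun x hx => by rw [hk x hx, hk' x hx]) (h ▸ Submodule.mem_top)

/-- The polar functionals tight on given points of `P` form a face of the polar body, so extreme
points of this set are extreme in the whole body. -/
theorem isExtreme_polarAt : IsExtreme ℝ (polarAt P o)
    {k ∈ polarAt P o | ∀ x ∈ F ∩ P, k (x - o) = 1} := by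
  refine ⟨fun k hk => hk.1, ?_⟩
  rintro k hk l hl m ⟨hm, hm2⟩ ⟨a, b, ha, hb, hab, rfl⟩
  refine ⟨hk, fun x hx => ?_⟩
  have h1 := hk x hx.2
  have h2 := hl x hx.2
  have h3 := hm2 x hx
  rw [add_apply, smul_apply, smul_apply, smul_eq_mul, smul_eq_mul] at h3
  refine le_antisymm h1 (not_lt.1 fun h4 => ?_)
  have := mul_lt_mul_of_pos_left h4 ha
  have := mul_le_mul_of_nonneg_left h2 hb.le
  linarith

theorem mem_extremePoints_of_relSpan_eq_top (hk : k ∈ polarAt P o)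
    (h : relSpan o (touch P o k) = ⊤) : k ∈ (polarAt P o).extremePoints ℝ := by
  refine ⟨hk, fun k₁ h1 k₂ h2 hseg => ?_⟩
  have := (isExtreme_polarAt (F := touch P o k)).left_mem_of_mem_openSegment h1 h2
    ⟨hk, fun x hx => hx.1.2⟩ hseg
  exact eq_of_relSpan_eq_top h (fun x hx => this.2 x ⟨hx, hx.1⟩) fun x hx => hx.2

/-- The normalised functional defining the facet `F`. -/
def facetFn (o : E) (F : Facet P) : E →L[ℝ] ℝ :=
  Classical.epsilon fun k => k ∈ polarAt P o ∧ F.1 = touch P o k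

theorem facet_ne (F : Facet P) : F.1 ≠ P := fun h => by
  have := F.2.2.2
  rw [h] at this
  omega

theorem facetFn_spec (ho : o ∈ interior P) (F : Facet P) :
    facetFn o F ∈ polarAt P o ∧ F.1 = touch P o (facetFn o F) := by
  obtain ⟨k, hk⟩ := exists_touch_of_isExposed ho F.2.1 F.2.2.1 (facet_ne F)
  exact Classical.epsilon_spec (p := fun k => k ∈ polarAt P o ∧ F.1 = touch P o k) ⟨k, hk⟩

theorem facetFn_le (ho : o ∈ interior P) (F : Facet P) {x : E} (hx : x ∈ P) :
    facetFn o F (x - o) ≤ 1 := (facetFn_spec ho F).1 x hx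

theorem facetFn_eq (ho : o ∈ interior P) (F : Facet P) {x : E} (hx : x ∈ F.1) :
    facetFn o F (x - o) = 1 := by
  rw [(facetFn_spec ho F).2] at hx
  exact hx.2

theorem mem_facet_iff (ho : o ∈ interior P) (F : Facet P) {x : E} :
    x ∈ F.1 ↔ x ∈ P ∧ facetFn o F (x - o) = 1 := by
  conv_lhs => rw [(facetFn_spec ho F).2]
  rfl

theorem facetFn_injective (ho : o ∈ interior P) :
    Function.Injective (facetFn o : Facet P → (E →L[ℝ] ℝ)) := by
  intro F G h
  apply Subtype.ext
  rw [(facetFn_spec ho F).2, (facetFn_spec ho G).2, h]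

variable [FiniteDimensional ℝ E]

theorem relSpan_facet (ho : o ∈ interior P) (F : Facet P) : relSpan o F.1 = ⊤ := by
  apply Submodule.eq_top_of_finrank_eq
  rw [finrank_relSpan F.2.2.1 (fun x hx => facetFn_eq ho F hx), F.2.2.2, dim_eq_finrank ⟨o, ho⟩]

theorem eq_facetFn (ho : o ∈ interior P) (F : Facet P) (hk : ∀ x ∈ F.1, k (x - o) = 1) :
    k = facetFn o F :=
  eq_of_relSpan_eq_top (relSpan_facet ho F) hk fun _ hx => facetFn_eq ho F hx

theorem facetFn_mem_extremePoints (ho : o ∈ interior P) (F : Facet P) :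
    facetFn o F ∈ (polarAt P o).extremePoints ℝ :=
  mem_extremePoints_of_relSpan_eq_top (facetFn_spec ho F).1
    ((facetFn_spec ho F).2 ▸ relSpan_facet ho F)

/-- The tight set of an extreme functional spans, which is codimension one once it is non-empty.
Non-emptiness fails for a point, whose polar body is `{0}`. -/
theorem exists_facetFn_eq (hP : IsFullPolytope P) (ho : o ∈ interior P)
    (hk : k ∈ (polarAt P o).extremePoints ℝ) (hne : (touch P o k).Nonempty) :
    ∃ F : Facet P, facetFn o F = k := by
  have h := relSpan_touch_eq_top hP hk
  have h2 := finrank_relSpan hne (fun x hx => hx.2)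
  rw [h, finrank_top, ← dim_eq_finrank ⟨o, ho⟩] at h2
  let F : Facet P := ⟨touch P o k, touch_isExposed hk.1, hne, h2.symm⟩
  exact ⟨F, (eq_facetFn ho F fun x (hx : x ∈ touch P o k) => hx.2).symm⟩

/-- Maximise over the extreme points of the polar body; `0 < k v` forces `v ≠ 0`, which excludes
dimension zero and an empty tight set. -/
theorem exists_facetFn_ge (hP : IsFullPolytope P) (ho : o ∈ interior P) (hk : k ∈ polarAt P o)
    {v : E} (hv : 0 < k v) : ∃ F : Facet P, k v ≤ facetFn o F v := by
  obtain ⟨e, he, hle⟩ := exists_extremePoint_ge (polarAt_isCompact ho) hk v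
  have hne : (touch P o e).Nonempty := by
    by_contra h
    rw [not_nonempty_iff_eq_empty] at h
    have := relSpan_touch_eq_top hP he
    rw [h, relSpan, image_empty, Submodule.span_empty] at this
    have hv0 : v ∈ (⊥ : Submodule ℝ E) := this ▸ Submodule.mem_top
    rw [Submodule.mem_bot] at hv0
    simp [hv0] at hv
  obtain ⟨F, rfl⟩ := exists_facetFn_eq hP ho he hne
  exact ⟨F, hle⟩

/-- A hyperplane separating `x` from `P` normalises to a polar functional greater than one at `x -
o`, and some facet functional is at least as large there. -/
theorem mem_iff_facetFn_le (hP : IsFullPolytope P) (ho : o ∈ interior P) {x : E} :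
    x ∈ P ↔ ∀ F : Facet P, facetFn o F (x - o) ≤ 1 := by
  refine ⟨fun hx F => facetFn_le ho F hx, fun h => ?_⟩
  by_contra hx
  obtain ⟨f, u, hf, hu⟩ := geometric_hahn_banach_closed_point hP.convex hP.isCompact.isClosed hx
  have hfo := hf o (interior_subset ho)
  have hf0 : f ≠ 0 := by
    rintro rfl
    simp at hu hfo
    linarith
  obtain ⟨h0, h1, -⟩ := exists_polarAt_of_le ho hf0 (fun a ha => (hf a ha).le)
  have h2 : 1 < ((u - f o)⁻¹ • f) (x - o) := by
    rw [smul_apply, map_sub, smul_eq_mul, lt_inv_mul_iff₀ h0]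
    linarith
  obtain ⟨F, hF⟩ := exists_facetFn_ge hP ho h1 (one_pos.trans h2)
  exact (h2.trans_le hF).not_ge (h F)

theorem mem_interior_iff_facetFn_lt (hP : IsFullPolytope P) (ho : o ∈ interior P) {x : E} :
    x ∈ interior P ↔ ∀ F : Facet P, facetFn o F (x - o) < 1 := by
  refine ⟨fun hx F => lt_one_of_mem_interior (facetFn_spec ho F).1 hx, fun h => ?_⟩
  have := hP.finite_facet
  have hopen : IsOpen (⋂ F : Facet P, {y : E | facetFn o F (y - o) < 1}) :=
    isOpen_iInter_of_finite fun F => isOpen_lt (by fun_prop) continuous_const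
  refine interior_maximal ?_ hopen (mem_iInter.2 h)
  intro y hy
  rw [mem_iff_facetFn_le hP ho]
  exact fun F => (mem_iInter.1 hy F).le

theorem isCompact_polarAt_sep (ho : o ∈ interior P) :
    IsCompact {k ∈ polarAt P o | ∀ x ∈ F ∩ P, k (x - o) = 1} := by
  have hcl : IsClosed {k : E →L[ℝ] ℝ | ∀ x ∈ F ∩ P, k (x - o) = 1} := by
    have : {k : E →L[ℝ] ℝ | ∀ x ∈ F ∩ P, k (x - o) = 1} =
        ⋂ x ∈ F ∩ P, {k : E →L[ℝ] ℝ | k (x - o) = 1} := by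
      ext k; simp
    rw [this]
    exact isClosed_biInter fun x _ => isClosed_eq (by fun_prop) continuous_const
  exact (polarAt_isCompact ho).inter_right hcl

/-- Every non-empty proper face lies in a facet. -/
theorem exists_facet_superset (hP : IsFullPolytope P) (ho : o ∈ interior P)
    (hF : IsExposed ℝ P F) (hne : F.Nonempty) (hFP : F ≠ P) : ∃ G : Facet P, F ⊆ G.1 := by
  obtain ⟨k, hk, hFk⟩ := exists_touch_of_isExposed ho hF hne hFP
  -- An extreme point of this face of the polar body is a facet functional tight on `F`.
  set L := {k ∈ polarAt P o | ∀ x ∈ F ∩ P, k (x - o) = 1} with hL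
  have hLc : IsCompact L := isCompact_polarAt_sep ho
  have hLne : L.Nonempty := ⟨k, hk, fun x hx => (hFk ▸ hx.1 : x ∈ touch P o k).2⟩
  obtain ⟨e, he⟩ := hLc.extremePoints_nonempty hLne
  have he1 := (extremePoints_subset he).2
  have hsub : F ⊆ touch P o e := fun x hx => ⟨hF.subset hx, he1 x ⟨hx, hF.subset hx⟩⟩
  obtain ⟨G, rfl⟩ := exists_facetFn_eq hP ho
    (isExtreme_polarAt.extremePoints_subset_extremePoints he) (hne.mono hsub)
  exact ⟨G, (facetFn_spec ho G).2 ▸ hsub⟩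

end Facets

/-! ### Ridges as edges of the polar body; a facet and its neighbours -/

section Ridges

variable {E : Type*} [NormedAddCommGroup E] [NormedSpace ℝ E]

theorem ridge_ne {P R : Set E} (hR : IsRidge P R) : R ≠ P := by
  rintro rfl
  have := hR.2.2
  omega

variable [FiniteDimensional ℝ E]

/-- The annihilator of a hyperplane is a line; `v` is a coordinate on it. -/
theorem exists_dual_of_finrank_add_one {W : Submodule ℝ E}
    (hW : Module.finrank ℝ W + 1 = Module.finrank ℝ E) :
    ∃ (h : E →L[ℝ] ℝ) (v : E), h v = 1 ∧ (∀ w ∈ W, h w = 0) ∧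
      ∀ h' : E →L[ℝ] ℝ, (∀ w ∈ W, h' w = 0) → h' = h' v • h := by
  have hne : W ≠ ⊤ := by
    rintro rfl
    rw [finrank_top] at hW
    omega
  obtain ⟨h, h0, hh⟩ := exists_dual_ne_zero hne
  obtain ⟨v, hv⟩ : ∃ v, h v ≠ 0 := by
    by_contra! h1
    exact h0 (ContinuousLinearMap.ext h1)
  have hker : W = LinearMap.ker (h : E →ₗ[ℝ] ℝ) := by
    apply Submodule.eq_of_le_of_finrank_eq (fun w hw => hh w hw)
    have h2 : (h : Module.Dual ℝ E) ≠ 0 := fun h1 => h0 (by ext x; exact LinearMap.congr_fun h1 x)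
    have := Module.Dual.finrank_ker_add_one_of_ne_zero h2
    omega
  refine ⟨h, (h v)⁻¹ • v, by simp [hv], hh, fun h' hh' => ?_⟩
  ext x
  have hx : x - (h x / h v) • v ∈ W := by
    rw [hker]
    simp [hv]
  have := hh' _ hx
  rw [map_sub, map_smul, sub_eq_zero] at this
  rw [this, smul_apply, map_smul]
  simp only [smul_eq_mul]
  field_simp

variable {P F : Set E} {o : E} {k : E →L[ℝ] ℝ}

/-- A ridge lies in exactly two facets, and every valid inequality that is tight on the ridge is a
convex combination of the two facet inequalities. -/
theorem exists_facets_of_isRidge (hP : IsFullPolytope P) (ho : o ∈ interior P) {R : Set E}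
    (hR : IsRidge P R) :
    ∃ F G : Facet P, F ≠ G ∧ R = F.1 ∩ G.1 ∧ (∀ H : Facet P, R ⊆ H.1 → H = F ∨ H = G) ∧
      ∀ k ∈ polarAt P o, (∀ x ∈ R, k (x - o) = 1) →
        ∃ t : ℝ, 0 ≤ t ∧ t ≤ 1 ∧ k = (1 - t) • facetFn o F + t • facetFn o G := by
  obtain ⟨kR, hkR, hRk⟩ := exists_touch_of_isExposed ho hR.1 hR.2.1 (ridge_ne hR)
  have hRP : R ⊆ P := hR.1.subset
  have hkR1 : ∀ x ∈ R, kR (x - o) = 1 := fun x hx => (hRk ▸ hx : x ∈ touch P o kR).2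
  have hrank : Module.finrank ℝ (relSpan o R) + 1 = Module.finrank ℝ E := by
    rw [finrank_relSpan hR.2.1 hkR1, ← dim_eq_finrank ⟨o, ho⟩, ← hR.2.2]
  obtain ⟨h, v, hv, hh, huniq⟩ := exists_dual_of_finrank_add_one hrank
  -- `L` is the edge of the polar body dual to `R`. It is a compact segment in direction `h`, with
  -- coordinate `k ↦ k v`, and its ends `k1`, `k2` are the two facets.
  set L := {k ∈ polarAt P o | ∀ x ∈ R ∩ P, k (x - o) = 1} with hL
  have hLc : IsCompact L := isCompact_polarAt_sep ho
  have hkRL : kR ∈ L := ⟨hkR, fun x hx => hkR1 x hx.1⟩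
  have hdiff : ∀ k ∈ L, ∀ l ∈ L, k = l + (k v - l v) • h := by
    intro k hk l hl
    have := huniq (k - l) (fun w hw => by
      rw [sub_apply, sub_eq_zero]
      exact eq_on_relSpan (fun x hx => by rw [hk.2 x ⟨hx, hRP hx⟩, hl.2 x ⟨hx, hRP hx⟩]) hw)
    rw [sub_apply] at this
    rw [← this]; abel
  have hev : Continuous fun k : E →L[ℝ] ℝ => k v := by fun_prop
  obtain ⟨k1, hk1, hmin⟩ := hLc.exists_isMinOn ⟨kR, hkRL⟩ hev.continuousOn
  obtain ⟨k2, hk2, hmax⟩ := hLc.exists_isMaxOn ⟨kR, hkRL⟩ hev.continuousOn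
  have hmin' : ∀ k ∈ L, k1 v ≤ k v := fun k hk => hmin hk
  have hmax' : ∀ k ∈ L, k v ≤ k2 v := fun k hk => hmax hk
  have hext1 : k1 ∈ (polarAt P o).extremePoints ℝ := by
    refine isExtreme_polarAt.extremePoints_subset_extremePoints (A := polarAt P o) (B := L)
      ⟨hk1, fun a ha b hb hab => ?_⟩
    have h1 := hmin' a ha
    have h2 := hmin' b hb
    obtain ⟨s, t, hs, ht, hst, e⟩ := hab
    have h3 : k1 v = s * a v + t * b v := by rw [← e]; simp
    have h4 : a v = k1 v := by
      refine le_antisymm (not_lt.1 fun h4 => ?_) h1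
      have := mul_lt_mul_of_pos_left h4 hs
      have := mul_le_mul_of_nonneg_left h2 ht.le
      have : s * k1 v + t * k1 v = k1 v := by rw [← add_mul, hst, one_mul]
      linarith
    rw [hdiff a ha k1 hk1, h4]; simp
  have hext2 : k2 ∈ (polarAt P o).extremePoints ℝ := by
    refine isExtreme_polarAt.extremePoints_subset_extremePoints (A := polarAt P o) (B := L)
      ⟨hk2, fun a ha b hb hab => ?_⟩
    have h1 := hmax' a ha
    have h2 := hmax' b hb
    obtain ⟨s, t, hs, ht, hst, e⟩ := hab
    have h3 : k2 v = s * a v + t * b v := by rw [← e]; simp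
    have h4 : a v = k2 v := by
      refine le_antisymm h1 (not_lt.1 fun h4 => ?_)
      have := mul_lt_mul_of_pos_left h4 hs
      have := mul_le_mul_of_nonneg_left h2 ht.le
      have : s * k2 v + t * k2 v = k2 v := by rw [← add_mul, hst, one_mul]
      linarith
    rw [hdiff a ha k2 hk2, h4]; simp
  have hsub : ∀ k ∈ L, R ⊆ touch P o k := fun k hk x hx => ⟨hRP hx, hk.2 x ⟨hx, hRP hx⟩⟩
  obtain ⟨F, hF⟩ := exists_facetFn_eq hP ho hext1 (hR.2.1.mono (hsub k1 hk1))
  obtain ⟨G, hG⟩ := exists_facetFn_eq hP ho hext2 (hR.2.1.mono (hsub k2 hk2))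
  have hF1 : F.1 = touch P o k1 := hF ▸ (facetFn_spec ho F).2
  have hG1 : G.1 = touch P o k2 := hG ▸ (facetFn_spec ho G).2
  -- If the segment were a point, `R` would be the whole tight set of `k1`, which is a facet,
  -- against its dimension.
  have hlt : k1 v < k2 v := by
    refine lt_of_le_of_ne (hmin' k2 hk2) fun heq => ?_
    have h1 : kR = k1 := by
      have h2 : kR v = k1 v := le_antisymm (heq ▸ hmax' kR hkRL) (hmin' kR hkRL)
      rw [hdiff kR hkRL k1 hk1, h2]; simp
    have h2 : R = F.1 := by rw [hF1, hRk, h1]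
    have h3 := F.2.2.2
    have h4 := hR.2.2
    rw [h2] at h4
    omega
  have hcomb : ∀ k ∈ L, ∃ t : ℝ, 0 ≤ t ∧ t ≤ 1 ∧ k = (1 - t) • k1 + t • k2 := by
    intro k hk
    have hpos : 0 < k2 v - k1 v := by linarith
    refine ⟨(k v - k1 v) / (k2 v - k1 v), div_nonneg (by linarith [hmin' k hk]) hpos.le,
      (div_le_one hpos).2 (by linarith [hmax' k hk]), ?_⟩
    have e := hdiff k2 hk2 k1 hk1
    have ht : k v - k1 v = (k v - k1 v) / (k2 v - k1 v) * (k2 v - k1 v) :=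
      (div_mul_cancel₀ _ hpos.ne').symm
    generalize (k v - k1 v) / (k2 v - k1 v) = t at ht
    calc k = k1 + (k v - k1 v) • h := hdiff k hk k1 hk1
      _ = (1 - t) • k1 + t • (k1 + (k2 v - k1 v) • h) := by rw [ht]; module
      _ = (1 - t) • k1 + t • k2 := by rw [← e]
  refine ⟨F, G, ?_, ?_, ?_, ?_⟩
  · rintro rfl
    rw [← hF, ← hG] at hlt
    exact lt_irrefl _ hlt
  · apply Subset.antisymm
    · rw [hF1, hG1]
      exact subset_inter (hsub k1 hk1) (hsub k2 hk2)
    · rintro x ⟨hx1, hx2⟩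
      rw [hF1] at hx1
      rw [hG1] at hx2
      obtain ⟨t, -, -, ht⟩ := hcomb kR hkRL
      rw [hRk]
      refine ⟨hx1.1, ?_⟩
      rw [ht, add_apply, smul_apply, smul_apply, hx1.2, hx2.2]
      simp
  · intro H hH
    have hHL : facetFn o H ∈ L := ⟨(facetFn_spec ho H).1, fun x hx => facetFn_eq ho H (hH hx.1)⟩
    obtain ⟨t, h0, h1, ht⟩ := hcomb _ hHL
    rcases h0.eq_or_lt with rfl | h0
    · left
      apply facetFn_injective ho
      rw [ht, hF]; simp
    rcases h1.eq_or_lt with rfl | h1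
    · right
      apply facetFn_injective ho
      rw [ht, hG]; simp
    left
    apply facetFn_injective ho
    rw [hF]
    exact ((facetFn_mem_extremePoints ho H).2 hk1.1 hk2.1
      ⟨1 - t, t, by linarith, h0, by ring, ht.symm⟩).symm
  · intro k hk hkx
    rw [hF, hG]
    exact hcomb k ⟨hk, fun x hx => hkx x hx.1⟩

/-- An inequality tight at a generic point of `F` is tight on all of `F`, which determines it as the
inequality of `F`. -/
theorem facetFn_lt_of_generic (ho : o ∈ interior P) (F G : Facet P) (hne : G ≠ F) {z : E}
    (hz : ∀ (k : E →L[ℝ] ℝ) (c : ℝ), (∀ x ∈ F.1, k x ≤ c) → k z = c → ∀ x ∈ F.1, k x = c)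
    (hzF : z ∈ F.1) : facetFn o G (z - o) < 1 := by
  refine lt_of_le_of_ne (facetFn_le ho G (F.2.1.subset hzF)) fun h => hne ?_
  apply facetFn_injective ho
  apply eq_facetFn ho F
  intro x hx
  have := hz (facetFn o G) (1 + facetFn o G o) (fun x hx => by
    have := facetFn_le ho G (F.2.1.subset hx)
    rw [map_sub] at this
    linarith) (by rw [map_sub] at h; linarith) x hx
  rw [map_sub]
  linarith

theorem exists_finrank_le_one (hd : Module.finrank ℝ E ≤ 1) {l : E →L[ℝ] ℝ} (hl : l ≠ 0) {v : E}
    (hv : l v = 0) : v = 0 := by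
  have h2 : (l : Module.Dual ℝ E) ≠ 0 := fun h1 => hl (by ext x; exact LinearMap.congr_fun h1 x)
  have := Module.Dual.finrank_ker_add_one_of_ne_zero h2
  have h3 : LinearMap.ker (l : Module.Dual ℝ E) = ⊥ := by
    rw [← Submodule.finrank_eq_zero (R := ℝ)]
    omega
  have : v ∈ LinearMap.ker (l : Module.Dual ℝ E) := hv
  rwa [h3, Submodule.mem_bot] at this

/-- A facet is cut out of its hyperplane by the inequalities of the adjacent facets. -/
theorem mem_facet_of_adjacent (hP : IsFullPolytope P) (ho : o ∈ interior P) (F : Facet P) {y : E}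
    (hy : facetFn o F (y - o) = 1)
    (hadj : ∀ G : Facet P, IsRidge P (F.1 ∩ G.1) → facetFn o G (y - o) ≤ 1) : y ∈ F.1 := by
  have hfin := hP.finite_facet
  refine (mem_facet_iff ho F).2 ⟨?_, hy⟩
  obtain ⟨z, hzF, hz⟩ := hP.exists_generic F.2.1 F.2.2.1
  have hzlt : ∀ G : Facet P, G ≠ F → facetFn o G (z - o) < 1 :=
    fun G hG => facetFn_lt_of_generic ho F G hG hz hzF
  have hFz := facetFn_eq ho F hzF
  rw [mem_iff_facetFn_le hP ho]
  by_contra! hH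
  obtain ⟨H, hH⟩ := hH
  have hHF : H ≠ F := by
    rintro rfl
    linarith
  -- The level `c` separates `F`, with value one at `z`, from all other facets.
  obtain ⟨c, hc1, hc⟩ : ∃ c < (1 : ℝ), ∀ G : Facet P, G ≠ F → facetFn o G (z - o) < c := by
    have hev : ∀ᶠ c in nhdsWithin (1 : ℝ) (Iio 1), ∀ G : Facet P, G ≠ F →
        facetFn o G (z - o) < c := by
      rw [Filter.eventually_all]
      intro G
      by_cases h : G = F
      · simp [h]
      · exact ((lt_mem_nhds (hzlt G h)).filter_mono nhdsWithin_le_nhds).mono fun c hc _ => hc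
    obtain ⟨c, hc, hc1⟩ := (hev.and self_mem_nhdsWithin).exists
    exact ⟨c, hc1, hc⟩
  -- This slice is the vertex figure of the polar body at `facetFn o F`. Its vertices lie on edges
  -- of the body that leave `F`, that is, on ridges of `P` inside `F`.
  set S := {k ∈ polarAt P o | k (z - o) = c} with hS
  have hSc : IsCompact S := (polarAt_isCompact ho).inter_right
    (isClosed_eq (f := fun k : E →L[ℝ] ℝ => k (z - o)) (by fun_prop) continuous_const)
  have hk' : ∃ k ∈ S, 1 < k (y - o) := by
    have hHz := hc H hHF
    -- `θ` is chosen so that the point of the segment from `F` to the violated facet `H` lies in the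
    -- slice.
    set θ := (1 - c) / (1 - facetFn o H (z - o)) with hθ
    have hd : 0 < 1 - facetFn o H (z - o) := by linarith
    have h0 : 0 < θ := div_pos (by linarith) hd
    have h1 : θ ≤ 1 := (div_le_one hd).2 (by linarith)
    refine ⟨(1 - θ) • facetFn o F + θ • facetFn o H,
      ⟨polarAt_convex (facetFn_spec ho F).1 (facetFn_spec ho H).1 (by linarith) h0.le (by ring), ?_⟩, ?_⟩
    · rw [add_apply, smul_apply, smul_apply, hFz, hθ]
      simp only [smul_eq_mul]
      field_simp
      ring
    · rw [add_apply, smul_apply, smul_apply, hy]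
      simp only [smul_eq_mul]
      nlinarith
  obtain ⟨k', hk'S, hk'y⟩ := hk'
  obtain ⟨k, hk, hle⟩ := exists_extremePoint_ge hSc hk'S (y - o)
  have hkS := extremePoints_subset hk
  have hky : 1 < k (y - o) := lt_of_lt_of_le hk'y hle
  -- Extremality in the slice loses at most one dimension of tight points. None cannot be lost,
  -- since no facet has the value `c` at `z`; so the tight set of `k` is a ridge or empty.
  have hspan : relSpan o (touch P o k) ⊔ Submodule.span ℝ {z - o} = ⊤ := by
    by_contra hW
    obtain ⟨h, h0, hh⟩ := exists_dual_ne_zero hW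
    obtain ⟨ε, hε, h1, h2⟩ := exists_ne_zero_perturbation hP hkS.1
      (fun x hx => hh _ (Submodule.mem_sup_left (sub_mem_relSpan hx)))
    have hhz : h (z - o) = 0 := hh _ (Submodule.mem_sup_right (Submodule.mem_span_singleton_self _))
    have := hk.2 ⟨h1, by simpa [← map_sub, hhz] using hkS.2⟩
      ⟨h2, by simpa [← map_sub, hhz] using hkS.2⟩ (mem_openSegment_perturbation k h ε)
    simp [hε, h0] at this
  have hntop : relSpan o (touch P o k) ≠ ⊤ := by
    intro htop
    have hke := mem_extremePoints_of_relSpan_eq_top hkS.1 htop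
    have hne : (touch P o k).Nonempty := by
      by_contra hne
      rw [not_nonempty_iff_eq_empty] at hne
      rw [hne, relSpan, image_empty, Submodule.span_empty] at htop
      have hv0 : y - o ∈ (⊥ : Submodule ℝ E) := htop ▸ Submodule.mem_top
      rw [Submodule.mem_bot] at hv0
      rw [hv0, map_zero] at hky
      linarith
    obtain ⟨G, rfl⟩ := exists_facetFn_eq hP ho hke hne
    by_cases hG : G = F
    · subst hG
      linarith [hkS.2]
    · linarith [hc G hG, hkS.2]
  have hrank : Module.finrank ℝ (relSpan o (touch P o k)) + 1 = Module.finrank ℝ E := by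
    have h1 := Submodule.finrank_add_le_finrank_add_finrank (relSpan o (touch P o k))
      (Submodule.span ℝ {z - o})
    rw [hspan, finrank_top] at h1
    have h2 := finrank_span_le_card (R := ℝ) ({z - o} : Set E)
    simp only [Set.toFinset_singleton, Finset.card_singleton] at h2
    have h3 := Submodule.finrank_lt hntop
    omega
  by_cases hne : (touch P o k).Nonempty
  · have hridge : IsRidge P (touch P o k) := by
      refine ⟨touch_isExposed hkS.1, hne, ?_⟩
      rw [dim_eq_finrank ⟨o, ho⟩, ← hrank, finrank_relSpan hne fun x hx => hx.2]
    -- One of the two facets through the ridge must be `F`, as otherwise the value at `z` is below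
    -- `c`. The other is adjacent to `F`, so `k (y - o) ≤ 1`, a contradiction.
    obtain ⟨G, G', hGG, hRG, -, hcomb⟩ := exists_facets_of_isRidge hP ho hridge
    obtain ⟨t, h0, h1, ht⟩ := hcomb k hkS.1 fun x hx => hx.2
    have hkz := hkS.2
    rw [ht, add_apply, smul_apply, smul_apply, smul_eq_mul, smul_eq_mul] at hkz hky
    by_cases hG : G = F
    · subst hG
      have := hadj G' (hRG ▸ hridge)
      nlinarith
    by_cases hG' : G' = F
    · subst hG'
      have := hadj G (by rw [inter_comm]; exact hRG ▸ hridge)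
      nlinarith
    have e1 := hc G hG
    have e2 := hc G' hG'
    have e3 : (1 - t) * facetFn o G (z - o) ≤ (1 - t) * c :=
      mul_le_mul_of_nonneg_left e1.le (by linarith)
    rcases h0.eq_or_lt with rfl | h0
    · linarith
    · have := mul_lt_mul_of_pos_left e2 h0
      linarith
  -- No tight point occurs only in dimension one, where the hyperplane of `F` is a single point and
  -- `y = z`.
  · rw [not_nonempty_iff_eq_empty] at hne
    rw [hne, relSpan, image_empty, Submodule.span_empty, finrank_bot] at hrank
    have hF0 : facetFn o F ≠ 0 := by
      intro h
      rw [h] at hy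
      simp at hy
    have : y - z = 0 := exists_finrank_le_one (by omega) hF0 (by
      have : y - z = (y - o) - (z - o) := by abel
      rw [this, map_sub, hy, hFz, sub_self])
    rw [sub_eq_zero] at this
    rw [this] at hH
    linarith [hzlt H hHF]

end Ridges

/-! ### Flat families: from adjacent facets to all facets -/

section FlatFamilies

variable {E : Type*} [NormedAddCommGroup E] [NormedSpace ℝ E]

/-- One point beyond each facet such that, for every ridge, the ridge and the points beyond the
adjacent facets lie in a common supporting hyperplane. -/
def IsFlat (P : Set E) (p : Facet P → E) : Prop :=
  (∀ F : Facet P, IsBeyond P F.1 (p F)) ∧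
    ∀ R : Set E, IsRidge P R → ∃ (l : E →L[ℝ] ℝ) (c : ℝ), l ≠ 0 ∧ (∀ x ∈ P, l x ≤ c) ∧
      (∀ x ∈ R, l x = c) ∧ ∀ F : Facet P, R ⊆ F.1 → l (p F) = c

/-- The functional of a supporting hyperplane through the ridge `R` and the points beyond the
facets containing it. -/
def IsRidgeFn (P : Set E) (o : E) (p : Facet P → E) (R : Set E) (m : E →L[ℝ] ℝ) : Prop :=
  m ∈ polarAt P o ∧ (∀ x ∈ R, m (x - o) = 1) ∧ ∀ F : Facet P, R ⊆ F.1 → m (p F - o) = 1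

/-- A choice of ridge functional. -/
def ridgeFn (P : Set E) (o : E) (p : Facet P → E) (R : Set E) : E →L[ℝ] ℝ :=
  Classical.epsilon (IsRidgeFn P o p R)

/-- The point `z` of the face lies strictly between `y` and a prolongation that stays in `P`, so the
extreme set `x` contains `y`. -/
theorem mem_of_extend_mem {P x : Set E} (hx : IsExposed ℝ P x) {y z : E} (hz : z ∈ x)
    (hy : y ∈ P) {ε : ℝ} (hε : 0 < ε) (hw : z + ε • (z - y) ∈ P) : y ∈ x := by
  refine hx.isExtreme.left_mem_of_mem_openSegment hy hw hz
    ⟨ε / (1 + ε), 1 / (1 + ε), by positivity, by positivity, by field_simp; ring, ?_⟩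
  have h : (1 + ε) ≠ 0 := by positivity
  have : ε / (1 + ε) = ε * (1 / (1 + ε)) := by ring
  rw [this]
  have h2 : (1 / (1 + ε)) * (1 + ε) = 1 := by field_simp
  generalize 1 / (1 + ε) = a at h2
  calc (ε * a) • y + a • (z + ε • (z - y)) = (a * (1 + ε)) • z := by module
    _ = z := by rw [h2, one_smul]

theorem apply_extend (l : E →L[ℝ] ℝ) (y z o : E) (ε : ℝ) :
    l (z + ε • (z - y) - o) = l (z - o) + ε * (l (z - o) - l (y - o)) := by
  simp only [map_sub, map_add, map_smul, smul_eq_mul]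
  ring

theorem isBeyond_iff [FiniteDimensional ℝ E] {P : Set E} {o : E} (ho : o ∈ interior P)
    (F : Facet P) {q : E} : IsBeyond P F.1 q ↔ 1 < facetFn o F (q - o) := by
  constructor
  · rintro ⟨l, c, h1, h2, h3⟩
    have hl : l ≠ 0 := by
      rintro rfl
      obtain ⟨x, hx⟩ := F.2.2.1
      have := h2 x hx
      simp at this h3
      linarith
    obtain ⟨h0, -, h5⟩ := exists_polarAt_of_le ho hl h1
    rw [← eq_facetFn ho F fun x hx => (h5 x).2 (h2 x hx), smul_apply, smul_eq_mul, map_sub,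
      lt_inv_mul_iff₀ h0]
    linarith
  · intro h
    refine ⟨facetFn o F, 1 + facetFn o F o, fun x hx => ?_, fun x hx => ?_, ?_⟩
    · have := facetFn_le ho F hx
      rw [map_sub] at this
      linarith
    · have := facetFn_eq ho F hx
      rw [map_sub] at this
      linarith
    · rw [map_sub] at h
      linarith

variable {P : Set E} {o : E} {p : Facet P → E}

theorem ridgeFn_spec (ho : o ∈ interior P) (hp : IsFlat P p) {R : Set E} (hR : IsRidge P R) :
    IsRidgeFn P o p R (ridgeFn P o p R) := by
  obtain ⟨l, c, hl, h1, h2, h3⟩ := hp.2 R hR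
  obtain ⟨-, h4, h5⟩ := exists_polarAt_of_le ho hl h1
  exact Classical.epsilon_spec (p := IsRidgeFn P o p R)
    ⟨_, h4, fun x hx => (h5 x).2 (h2 x hx), fun F hF => (h5 _).2 (h3 F hF)⟩

theorem ne_of_isRidge_inter {F G : Facet P} (h : IsRidge P (F.1 ∩ G.1)) : F ≠ G := by
  rintro rfl
  rw [inter_self] at h
  have h1 := h.2.2
  have h2 := F.2.2.2
  omega

theorem isFullPolytope_convexHull_union_range (hP : IsFullPolytope P) (p : Facet P → E) :
    IsFullPolytope (convexHull ℝ (P ∪ range p)) := by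
  have := hP.finite_facet
  refine ⟨?_, hP.2.mono (interior_mono (subset_union_left.trans (subset_convexHull ℝ _)))⟩
  obtain ⟨⟨s, hs, rfl⟩, -⟩ := hP
  exact ⟨s ∪ range p, hs.union (finite_range p), convexHull_convexHull_union_left s (range p)⟩

variable [FiniteDimensional ℝ E]

theorem eq_or_eq_of_isRidge_inter (hP : IsFullPolytope P) (ho : o ∈ interior P) {F G : Facet P}
    (h : IsRidge P (F.1 ∩ G.1)) {H : Facet P} (hH : F.1 ∩ G.1 ⊆ H.1) : H = F ∨ H = G := by
  have hne := ne_of_isRidge_inter h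
  obtain ⟨F', G', -, -, h3, -⟩ := exists_facets_of_isRidge hP ho h
  have e1 := h3 F inter_subset_left
  have e2 := h3 G inter_subset_right
  have e3 := h3 H hH
  rcases e1 with rfl | rfl <;> rcases e2 with rfl | rfl <;> rcases e3 with rfl | rfl <;> simp_all

theorem exists_comb_of_isRidge_inter (hP : IsFullPolytope P) (ho : o ∈ interior P) {F G : Facet P}
    (h : IsRidge P (F.1 ∩ G.1)) {k : E →L[ℝ] ℝ} (hk : k ∈ polarAt P o)
    (hkx : ∀ x ∈ F.1 ∩ G.1, k (x - o) = 1) :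
    ∃ t : ℝ, 0 ≤ t ∧ t ≤ 1 ∧ k = (1 - t) • facetFn o F + t • facetFn o G := by
  have hne := ne_of_isRidge_inter h
  obtain ⟨F', G', -, -, h3, h4⟩ := exists_facets_of_isRidge hP ho h
  obtain ⟨t, h0, h1, ht⟩ := h4 k hk hkx
  have e1 := h3 F inter_subset_left
  have e2 := h3 G inter_subset_right
  rcases e1 with rfl | rfl <;> rcases e2 with rfl | rfl
  · exact absurd rfl hne
  · exact ⟨t, h0, h1, ht⟩
  · exact ⟨1 - t, by linarith, by linarith, by rw [ht]; module⟩
  · exact absurd rfl hne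

theorem exists_facets_inter_of_isRidge (hP : IsFullPolytope P) (ho : o ∈ interior P) {R : Set E}
    (hR : IsRidge P R) : ∃ F G : Facet P, R = F.1 ∩ G.1 := by
  obtain ⟨F, G, -, h, -⟩ := exists_facets_of_isRidge hP ho hR
  exact ⟨F, G, h⟩

theorem one_lt_facetFn (ho : o ∈ interior P) (hp : IsFlat P p) (F : Facet P) :
    1 < facetFn o F (p F - o) := (isBeyond_iff ho F).1 (hp.1 F)

/-- The weights are strictly positive: at an end point the functional would be that of one facet and
exceed one at the point beyond it. -/
theorem ridgeFn_eq_comb (hP : IsFullPolytope P) (ho : o ∈ interior P) (hp : IsFlat P p)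
    {F G : Facet P} (h : IsRidge P (F.1 ∩ G.1)) : ∃ t : ℝ, 0 < t ∧ t < 1 ∧
      ridgeFn P o p (F.1 ∩ G.1) = (1 - t) • facetFn o F + t • facetFn o G := by
  have hs := ridgeFn_spec ho hp h
  obtain ⟨t, h0, h1, ht⟩ := exists_comb_of_isRidge_inter hP ho h hs.1 hs.2.1
  refine ⟨t, h0.lt_of_ne ?_, h1.lt_of_ne ?_, ht⟩
  · rintro rfl
    have := hs.2.2 F inter_subset_left
    rw [ht] at this
    simp only [sub_zero, one_smul, zero_smul, add_zero] at this
    linarith [one_lt_facetFn ho hp F]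
  · rintro rfl
    have := hs.2.2 G inter_subset_right
    rw [ht] at this
    simp only [sub_self, one_smul, zero_smul, zero_add] at this
    linarith [one_lt_facetFn ho hp G]

/-- A weighted mean of the two facet values at `p F` is one, and the value of `F` exceeds one. -/
theorem facetFn_lt_one_of_adjacent (hP : IsFullPolytope P) (ho : o ∈ interior P) (hp : IsFlat P p)
    {F G : Facet P} (h : IsRidge P (F.1 ∩ G.1)) : facetFn o G (p F - o) < 1 := by
  obtain ⟨t, h0, h1, ht⟩ := ridgeFn_eq_comb hP ho hp h
  have h2 := (ridgeFn_spec ho hp h).2.2 F inter_subset_left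
  have h3 := one_lt_facetFn ho hp F
  rw [ht, add_apply, smul_apply, smul_apply, smul_eq_mul, smul_eq_mul] at h2
  by_contra! h4
  have e1 := mul_le_mul_of_nonneg_left h4 h0.le
  have e2 := mul_lt_mul_of_pos_left h3 (show 0 < 1 - t by linarith)
  linarith

/-- A point of a facet that lies in no adjacent facet lies in no other facet. -/
theorem facetFn_lt_one_of_adjacent_lt (hP : IsFullPolytope P) (ho : o ∈ interior P) (G : Facet P)
    {y : E} (hy : facetFn o G (y - o) = 1)
    (hadj : ∀ F : Facet P, IsRidge P (G.1 ∩ F.1) → facetFn o F (y - o) < 1) (H : Facet P)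
    (hH : H ≠ G) : facetFn o H (y - o) < 1 := by
  have hfin := hP.finite_facet
  have hyG : y ∈ G.1 := mem_facet_of_adjacent hP ho G hy fun F hF => (hadj F hF).le
  refine lt_of_le_of_ne (facetFn_le ho H (G.2.1.subset hyG)) fun heq => hH ?_
  -- A neighbourhood of `y` in the hyperplane of `G` lies in `G`. If `H` were tight at `y`, it could
  -- not increase in any such direction, so it would be constant on the hyperplane and equal to `G`.
  have key : ∀ v, facetFn o G v = 0 → facetFn o H v ≤ 0 := by
    intro v hv
    have hev : ∀ᶠ ε in nhdsWithin (0 : ℝ) (Ioi 0), ∀ F : Facet P, IsRidge P (G.1 ∩ F.1) →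
        facetFn o F (y + ε • v - o) < 1 := by
      refine Filter.Eventually.filter_mono nhdsWithin_le_nhds ?_
      rw [Filter.eventually_all]
      intro F
      by_cases h : IsRidge P (G.1 ∩ F.1)
      · have hc : Continuous (fun ε : ℝ => facetFn o F (y + ε • v - o)) := by fun_prop
        have := hc.tendsto 0
        simp only [zero_smul, add_zero] at this
        exact (this.eventually (gt_mem_nhds (hadj F h))).mono fun _ h _ => h
      · exact Filter.Eventually.of_forall fun _ h' => absurd h' h
    obtain ⟨ε, hε, hε0⟩ := (hev.and self_mem_nhdsWithin).exists
    have e : y + ε • v - o = (y - o) + ε • v := by abel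
    have h1 : y + ε • v ∈ G.1 := mem_facet_of_adjacent hP ho G
      (by rw [e, map_add, map_smul, hv, hy]; simp) fun F hF => (hε F hF).le
    have h2 := facetFn_le ho H (G.2.1.subset h1)
    rw [e, map_add, map_smul, heq, smul_eq_mul] at h2
    by_contra! h3
    have := mul_pos hε0 h3
    linarith
  apply facetFn_injective ho
  apply eq_facetFn ho G
  intro x hx
  have e : x - o = (y - o) + (x - y) := by abel
  have h0 : facetFn o G (x - y) = 0 := by
    have := facetFn_eq ho G hx
    rw [e, map_add, hy] at this
    linarith
  have h1 := key _ h0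
  have h2 := key (-(x - y)) (by rw [map_neg, h0, neg_zero])
  rw [map_neg] at h2
  rw [e, map_add, heq]
  linarith

/-- In a flat family, the point beyond a facet lies strictly beneath all other facets. -/
theorem facetFn_lt_one_of_ne (hP : IsFullPolytope P) (ho : o ∈ interior P) (hp : IsFlat P p)
    {H G : Facet P} (hne : H ≠ G) : facetFn o H (p G - o) < 1 := by
  by_contra! hge
  obtain ⟨h, hh, hgen⟩ := hP.exists_generic H.2.1 H.2.2.1
  have h1 : facetFn o G (h - o) < 1 := facetFn_lt_of_generic ho H G hne.symm hgen hh
  have h2 := one_lt_facetFn ho hp G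
  have h3 := facetFn_eq ho H hh
  have hhP := H.2.1.subset hh
  -- `s` marks where the segment from the generic point `h` of `H` to `p G` crosses the hyperplane
  -- of `G`. There all neighbours of `G` are strictly satisfied, hence `H` is too, although `H` has
  -- value at least one at both ends.
  set s := (1 - facetFn o G (h - o)) / (facetFn o G (p G - o) - facetFn o G (h - o)) with hs
  have hd : 0 < facetFn o G (p G - o) - facetFn o G (h - o) := by linarith
  have hs0 : 0 < s := div_pos (by linarith) hd
  have hs1 : s < 1 := (div_lt_one hd).2 (by linarith)
  have hval : ∀ l : E →L[ℝ] ℝ,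
      l ((1 - s) • h + s • p G - o) = (1 - s) * l (h - o) + s * l (p G - o) := by
    intro l
    have : (1 - s) • h + s • p G - o = (1 - s) • (h - o) + s • (p G - o) := by module
    rw [this, map_add, map_smul, map_smul, smul_eq_mul, smul_eq_mul]
  have hy1 : facetFn o G ((1 - s) • h + s • p G - o) = 1 := by
    rw [hval, hs]
    field_simp
    ring
  have hadj : ∀ F : Facet P, IsRidge P (G.1 ∩ F.1) →
      facetFn o F ((1 - s) • h + s • p G - o) < 1 := by
    intro F hF
    have e1 := mul_lt_mul_of_pos_left (facetFn_lt_one_of_adjacent hP ho hp hF) hs0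
    have e2 := mul_le_mul_of_nonneg_left (facetFn_le ho F hhP) (show 0 ≤ 1 - s by linarith)
    rw [hval]
    linarith
  have := facetFn_lt_one_of_adjacent_lt hP ho G hy1 hadj H hne
  rw [hval, h3] at this
  have e1 := mul_le_mul_of_nonneg_left hge hs0.le
  linarith

theorem IsFlat.injective (hP : IsFullPolytope P) (hp : IsFlat P p) : Function.Injective p := by
  obtain ⟨o, ho⟩ := hP.2
  intro F G h
  by_contra hne
  have h1 := facetFn_lt_one_of_ne hP ho hp hne
  have h2 := one_lt_facetFn ho hp F
  rw [h] at h2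
  linarith

theorem ridgeFn_le_one (hP : IsFullPolytope P) (ho : o ∈ interior P) (hp : IsFlat P p)
    {R : Set E} (hR : IsRidge P R) (H : Facet P) :
    ridgeFn P o p R (p H - o) ≤ 1 ∧ (ridgeFn P o p R (p H - o) = 1 → R ⊆ H.1) := by
  by_cases hRH : R ⊆ H.1
  · exact ⟨((ridgeFn_spec ho hp hR).2.2 H hRH).le, fun _ => hRH⟩
  obtain ⟨F, G, rfl⟩ := exists_facets_inter_of_isRidge hP ho hR
  obtain ⟨t, h0, h1, ht⟩ := ridgeFn_eq_comb hP ho hp hR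
  have hF : facetFn o F (p H - o) < 1 :=
    facetFn_lt_one_of_ne hP ho hp fun h => hRH (h ▸ inter_subset_left)
  have hG : facetFn o G (p H - o) < 1 :=
    facetFn_lt_one_of_ne hP ho hp fun h => hRH (h ▸ inter_subset_right)
  have : ridgeFn P o p (F.1 ∩ G.1) (p H - o) < 1 := by
    rw [ht, add_apply, smul_apply, smul_apply, smul_eq_mul, smul_eq_mul]
    have e1 := mul_lt_mul_of_pos_left hG h0
    have e2 := mul_lt_mul_of_pos_left hF (show 0 < 1 - t by linarith)
    linarith
  exact ⟨this.le, fun h => absurd h this.ne⟩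

theorem ridgeFn_mem_polarAt (hP : IsFullPolytope P) (ho : o ∈ interior P) (hp : IsFlat P p)
    {R : Set E} (hR : IsRidge P R) :
    ridgeFn P o p R ∈ polarAt (convexHull ℝ (P ∪ range p)) o := by
  intro x hx
  have := le_of_mem_convexHull (l := ridgeFn P o p R) (c := 1 + ridgeFn P o p R o) (fun y hy => by
    have : ridgeFn P o p R (y - o) ≤ 1 := by
      rcases hy with hy | ⟨H, rfl⟩
      · exact (ridgeFn_spec ho hp hR).1 y hy
      · exact (ridgeFn_le_one hP ho hp hR H).1
    rw [map_sub] at this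
    linarith) hx
  rw [map_sub]
  linarith

/-- Both weights in the combination are positive, so the mean is one on `P` only where both facet
inequalities are tight. -/
theorem mem_ridge_iff (hP : IsFullPolytope P) (ho : o ∈ interior P) (hp : IsFlat P p)
    {R : Set E} (hR : IsRidge P R) {x : E} (hx : x ∈ P) :
    x ∈ R ↔ ridgeFn P o p R (x - o) = 1 := by
  refine ⟨(ridgeFn_spec ho hp hR).2.1 x, fun h => ?_⟩
  obtain ⟨F, G, rfl⟩ := exists_facets_inter_of_isRidge hP ho hR
  obtain ⟨t, h0, h1, ht⟩ := ridgeFn_eq_comb hP ho hp hR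
  rw [ht, add_apply, smul_apply, smul_apply, smul_eq_mul, smul_eq_mul] at h
  have hF := facetFn_le ho F hx
  have hG := facetFn_le ho G hx
  refine ⟨(mem_facet_iff ho F).2 ⟨hx, le_antisymm hF ?_⟩,
    (mem_facet_iff ho G).2 ⟨hx, le_antisymm hG ?_⟩⟩
  · by_contra! h2
    have e1 := mul_le_mul_of_nonneg_left hG h0.le
    have e2 := mul_lt_mul_of_pos_left h2 (show 0 < 1 - t by linarith)
    linarith
  · by_contra! h2
    have e1 := mul_lt_mul_of_pos_left h2 h0
    have e2 := mul_le_mul_of_nonneg_left hF (show 0 ≤ 1 - t by linarith)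
    linarith

end FlatFamilies

/-! ### The supporting hyperplanes of the polytope spanned by a flat family -/

section FacesOfFlat

variable {E : Type*} [NormedAddCommGroup E] [NormedSpace ℝ E] {P : Set E} {o : E} {p : Facet P → E}

theorem IsFullPolytope.eq_zero_of_forall_mem (hP : IsFullPolytope P) {z u : E}
    (h : ∀ s : ℝ, 0 ≤ s → z + s • u ∈ P) : u = 0 := by
  obtain ⟨r, hr⟩ := isBounded_iff_forall_norm_le.1 hP.isCompact.isBounded
  by_contra hu
  have hu' : 0 < ‖u‖ := norm_pos_iff.2 hu
  have h0 : 0 ≤ r := (norm_nonneg _).trans (hr _ (h 0 le_rfl))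
  have h1 := hr _ (h ((r + ‖z‖ + 1) / ‖u‖) (by positivity))
  have h2 : ‖((r + ‖z‖ + 1) / ‖u‖) • u‖ = r + ‖z‖ + 1 := by
    rw [norm_smul, Real.norm_of_nonneg (by positivity)]
    field_simp
  have h3 := norm_sub_le (z + ((r + ‖z‖ + 1) / ‖u‖) • u) z
  rw [add_sub_cancel_left, h2] at h3
  linarith

variable [FiniteDimensional ℝ E]

theorem exists_pos_forall_mem (hP : IsFullPolytope P) (ho : o ∈ interior P) {z v : E}
    (h : ∀ F : Facet P, facetFn o F (z - o) < 1 ∨ facetFn o F (z - o) ≤ 1 ∧ facetFn o F v ≤ 0) :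
    ∃ ε : ℝ, 0 < ε ∧ z + ε • v ∈ P := by
  have hfin := hP.finite_facet
  have hev : ∀ᶠ ε in nhdsWithin (0 : ℝ) (Ioi 0), ∀ F : Facet P,
      facetFn o F (z + ε • v - o) ≤ 1 := by
    rw [Filter.eventually_all]
    intro F
    rcases h F with h | ⟨h1, h2⟩
    · refine Filter.Eventually.filter_mono nhdsWithin_le_nhds ?_
      have hc : Continuous (fun ε : ℝ => facetFn o F (z + ε • v - o)) := by fun_prop
      have := hc.tendsto 0
      simp only [zero_smul, add_zero] at this
      exact (this.eventually (gt_mem_nhds h)).mono fun _ h => h.le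
    · filter_upwards [self_mem_nhdsWithin] with ε hε
      have e : z + ε • v - o = (z - o) + ε • v := by abel
      rw [e, map_add, map_smul, smul_eq_mul]
      have := mul_nonpos_of_nonneg_of_nonpos (le_of_lt (show (0 : ℝ) < ε from hε)) h2
      linarith
  obtain ⟨ε, hε, hε0⟩ := (hev.and self_mem_nhdsWithin).exists
  exact ⟨ε, hε0, (mem_iff_facetFn_le hP ho).2 hε⟩

/-- No point of the hyperplane of a facet is weakly beyond all adjacent facets. -/
theorem not_forall_adjacent_ge (hP : IsFullPolytope P) (ho : o ∈ interior P) (hd : 2 ≤ dim P)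
    (F : Facet P) {y : E} (hy : facetFn o F (y - o) = 1) :
    ¬ ∀ G : Facet P, IsRidge P (F.1 ∩ G.1) → 1 ≤ facetFn o G (y - o) := by
  intro h
  obtain ⟨z, hz, hgen⟩ := hP.exists_generic F.2.1 F.2.2.1
  have hlt : ∀ G : Facet P, IsRidge P (F.1 ∩ G.1) → facetFn o G (z - o) < 1 := fun G hG =>
    facetFn_lt_of_generic ho F G (ne_of_isRidge_inter hG).symm hgen hz
  have hFz := facetFn_eq ho F hz
  -- The ray from `z` away from `y` increases no adjacent inequality, so it stays in the bounded
  -- facet.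
  have hzy : z - y = 0 := by
    apply hP.eq_zero_of_forall_mem (z := z)
    intro s hs
    refine F.2.1.subset (mem_facet_of_adjacent hP ho F ?_ fun G hG => ?_)
    · rw [apply_extend, hFz, hy]
      simp
    · rw [apply_extend]
      have h1 := hlt G hG
      have h2 := h G hG
      have := mul_nonneg hs (show 0 ≤ facetFn o G (y - o) - facetFn o G (z - o) by linarith)
      linarith
  rw [sub_eq_zero] at hzy
  subst hzy
  have hno : ∀ G : Facet P, ¬ IsRidge P (F.1 ∩ G.1) := fun G hG => by
    linarith [h G hG, hlt G hG]
  -- Without adjacent facets nothing bounds `F` inside its hyperplane, so the hyperplane is a point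
  -- and the dimension at most one.
  have hker : ∀ v, facetFn o F v = 0 → v = 0 := by
    intro v hv
    apply hP.eq_zero_of_forall_mem (z := z)
    intro s hs
    refine F.2.1.subset (mem_facet_of_adjacent hP ho F ?_ fun G hG => absurd hG (hno G))
    have e : z + s • v - o = (z - o) + s • v := by abel
    rw [e, map_add, map_smul, hv, hy]
    simp
  have hinj : Function.Injective (facetFn o F) := by
    rw [injective_iff_map_eq_zero]
    exact hker
  have := LinearMap.finrank_le_finrank_of_injective (f := (facetFn o F : E →ₗ[ℝ] ℝ)) hinj
  rw [Module.finrank_self, ← dim_eq_finrank ⟨o, ho⟩] at this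
  omega

/-- A face of codimension at least three is the intersection of the ridges between it and any
facet containing it. -/
theorem IsLow.mem_of_adjacent (hP : IsFullPolytope P) (ho : o ∈ interior P) (hd : 2 ≤ dim P)
    {x : Set E} (hxP : IsExposed ℝ P x) (F : Facet P) (hxF : x ⊆ F.1)
    {y : E} (hy : y ∈ F.1)
    (hyG : ∀ G : Facet P, IsRidge P (F.1 ∩ G.1) → x ⊆ G.1 → y ∈ G.1) : y ∈ x := by
  rcases x.eq_empty_or_nonempty with rfl | hne
  · exfalso
    exact not_forall_adjacent_ge hP ho hd F (facetFn_eq ho F hy) fun G hG =>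
      (facetFn_eq ho G (hyG G hG (empty_subset _))).ge
  obtain ⟨z, hz, hgen⟩ := hP.exists_generic hxP hne
  have hfin := hP.finite_facet
  have hzF := facetFn_eq ho F (hxF hz)
  have hyF := facetFn_eq ho F hy
  have hev : ∀ᶠ ε in nhdsWithin (0 : ℝ) (Ioi 0), ∀ G : Facet P, IsRidge P (F.1 ∩ G.1) →
      facetFn o G (z + ε • (z - y) - o) ≤ 1 := by
    refine Filter.Eventually.filter_mono nhdsWithin_le_nhds ?_
    rw [Filter.eventually_all]
    intro G
    by_cases h : IsRidge P (F.1 ∩ G.1)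
    · by_cases hxG : x ⊆ G.1
      · refine Filter.Eventually.of_forall fun ε _ => ?_
        rw [apply_extend, facetFn_eq ho G (hxG hz), facetFn_eq ho G (hyG G h hxG)]
        simp
      · have hlt : facetFn o G (z - o) < 1 := by
          refine lt_of_le_of_ne (facetFn_le ho G (hxP.subset hz)) fun heq => hxG fun w hw => ?_
          refine (mem_facet_iff ho G).2 ⟨hxP.subset hw, ?_⟩
          have := hgen (facetFn o G) (1 + facetFn o G o) (fun w hw => by
            have := facetFn_le ho G (hxP.subset hw)
            rw [map_sub] at this
            linarith) (by rw [map_sub] at heq; linarith) w hw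
          rw [map_sub]
          linarith
        have hc : Continuous (fun ε : ℝ => facetFn o G (z + ε • (z - y) - o)) := by fun_prop
        have := hc.tendsto 0
        simp only [zero_smul, add_zero] at this
        exact (this.eventually (gt_mem_nhds hlt)).mono fun _ h _ => h.le
    · exact Filter.Eventually.of_forall fun _ h' => absurd h' h
  -- The segment from `y` can be prolonged beyond the generic point `z` inside `F`: facets
  -- containing `x` are tight at both points, the other adjacent ones are slack at `z`.
  obtain ⟨ε, hε, hε0⟩ := (hev.and self_mem_nhdsWithin).exists
  refine mem_of_extend_mem hxP hz (F.2.1.subset hy) hε0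
    (F.2.1.subset (mem_facet_of_adjacent hP ho F ?_ hε))
  rw [apply_extend, hzF, hyF]
  simp

/-- If `G` were the only possible neighbour through `x`, then `x` would be `F ∩ G` or `F`, too large
for codimension three. This second neighbour later separates the facets through `x`. -/
theorem IsLow.exists_adjacent_ne (hP : IsFullPolytope P) (ho : o ∈ interior P) (hd : 2 ≤ dim P)
    {x : Set E} (hxP : IsExposed ℝ P x) (hx : IsLow P x) (F : Facet P) (hxF : x ⊆ F.1)
    (G : Facet P) : ∃ G' : Facet P, G' ≠ G ∧ IsRidge P (F.1 ∩ G'.1) ∧ x ⊆ G'.1 := by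
  by_contra! h
  have hno : ∀ R : Set E, R.Nonempty → dim P ≤ dim R + 2 → R ≠ x := by
    rintro R hR hdim rfl
    rcases hx with rfl | hx
    · simp at hR
    · omega
  by_cases hG : IsRidge P (F.1 ∩ G.1) ∧ x ⊆ G.1
  · refine hno (F.1 ∩ G.1) hG.1.2.1 hG.1.2.2.ge (Subset.antisymm ?_ (subset_inter hxF hG.2))
    rintro y ⟨hyF, hyG⟩
    refine IsLow.mem_of_adjacent hP ho hd hxP F hxF hyF fun G' hG' hxG' => ?_
    by_cases hGG : G' = G
    · rwa [hGG]
    · exact absurd hxG' (h G' hGG hG')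
  · refine hno F.1 F.2.2.1 (by have := F.2.2.2; omega) (Subset.antisymm ?_ hxF)
    intro y hyF
    refine IsLow.mem_of_adjacent hP ho hd hxP F hxF hyF fun G' hG' hxG' => ?_
    by_cases hGG : G' = G
    · subst hGG
      exact absurd ⟨hG', hxG'⟩ hG
    · exact absurd hxG' (h G' hGG hG')

/-- The segment between the two new points meets the hyperplane of `F`. As the ridge functional is
one along it, it meets that of `G` at the same point, where all other facets are slack. So `r` is a
relative interior point of the ridge, and a face containing it contains the ridge. -/
theorem exists_mem_openSegment_ridge (hP : IsFullPolytope P) (ho : o ∈ interior P)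
    (hp : IsFlat P p) {F G : Facet P} (h : IsRidge P (F.1 ∩ G.1)) :
    ∃ r ∈ openSegment ℝ (p F) (p G), r ∈ F.1 ∩ G.1 ∧
      ∀ x, IsExposed ℝ P x → r ∈ x → F.1 ∩ G.1 ⊆ x := by
  have h1 := one_lt_facetFn ho hp F
  have h2 := facetFn_lt_one_of_ne hP ho hp (ne_of_isRidge_inter h)
  set s := (facetFn o F (p F - o) - 1) / (facetFn o F (p F - o) - facetFn o F (p G - o)) with hs
  have hd : 0 < facetFn o F (p F - o) - facetFn o F (p G - o) := by linarith
  have hs0 : 0 < s := div_pos (by linarith) hd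
  have hs1 : s < 1 := (div_lt_one hd).2 (by linarith)
  have hval : ∀ l : E →L[ℝ] ℝ,
      l ((1 - s) • p F + s • p G - o) = (1 - s) * l (p F - o) + s * l (p G - o) := by
    intro l
    have : (1 - s) • p F + s • p G - o = (1 - s) • (p F - o) + s • (p G - o) := by module
    rw [this, map_add, map_smul, map_smul, smul_eq_mul, smul_eq_mul]
  have hF : facetFn o F ((1 - s) • p F + s • p G - o) = 1 := by
    rw [hval, hs]
    field_simp
    ring
  have hG : facetFn o G ((1 - s) • p F + s • p G - o) = 1 := by
    obtain ⟨t, h0, h1, ht⟩ := ridgeFn_eq_comb hP ho hp h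
    have hspec := ridgeFn_spec ho hp h
    have e : ridgeFn P o p (F.1 ∩ G.1) ((1 - s) • p F + s • p G - o) = 1 := by
      rw [hval, hspec.2.2 F inter_subset_left, hspec.2.2 G inter_subset_right]
      ring
    rw [ht, add_apply, smul_apply, smul_apply, hF] at e
    simp only [smul_eq_mul] at e
    have : t * (facetFn o G ((1 - s) • p F + s • p G - o) - 1) = 0 := by linarith
    rcases mul_eq_zero.1 this with h' | h'
    · linarith
    · linarith
  have hother : ∀ H : Facet P, H ≠ F → H ≠ G →
      facetFn o H ((1 - s) • p F + s • p G - o) < 1 := by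
    intro H hHF hHG
    rw [hval]
    have e1 := mul_lt_mul_of_pos_left (facetFn_lt_one_of_ne hP ho hp hHF) (show 0 < 1 - s by linarith)
    have e2 := mul_lt_mul_of_pos_left (facetFn_lt_one_of_ne hP ho hp hHG) hs0
    linarith
  have hrP : (1 - s) • p F + s • p G ∈ P := by
    rw [mem_iff_facetFn_le hP ho]
    intro H
    by_cases hHF : H = F
    · rw [hHF, hF]
    by_cases hHG : H = G
    · rw [hHG, hG]
    exact (hother H hHF hHG).le
  refine ⟨(1 - s) • p F + s • p G, ⟨1 - s, s, by linarith, hs0, by ring, rfl⟩,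
    ⟨(mem_facet_iff ho F).2 ⟨hrP, hF⟩, (mem_facet_iff ho G).2 ⟨hrP, hG⟩⟩, ?_⟩
  rintro x hx hrx y ⟨hyF, hyG⟩
  obtain ⟨ε, hε, hmem⟩ := exists_pos_forall_mem hP ho (z := (1 - s) • p F + s • p G)
    (v := (1 - s) • p F + s • p G - y) (by
      intro H
      have e : (1 - s) • p F + s • p G - y = ((1 - s) • p F + s • p G - o) - (y - o) := by abel
      by_cases hHF : H = F
      · right
        rw [e, hHF, map_sub _ (_ - o), hF, facetFn_eq ho F hyF]
        simp
      by_cases hHG : H = G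
      · right
        rw [e, hHG, map_sub _ (_ - o), hG, facetFn_eq ho G hyG]
        simp
      · exact Or.inl (hother H hHF hHG))
  exact mem_of_extend_mem hx hrx (F.2.1.subset hyF) hε hmem

/-- The polytope spanned by a flat family is cut out by the ridge inequalities. -/
theorem mem_convexHull_of_ridgeFn_le (hP : IsFullPolytope P) (ho : o ∈ interior P)
    (hd : 2 ≤ dim P) (hp : IsFlat P p) {x : E}
    (hx : ∀ R, IsRidge P R → ridgeFn P o p R (x - o) ≤ 1) : x ∈ convexHull ℝ (P ∪ range p) := by
  by_cases hxP : x ∈ P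
  · exact subset_convexHull ℝ _ (Or.inl hxP)
  rw [mem_iff_facetFn_le hP ho] at hxP
  push Not at hxP
  obtain ⟨F, hF⟩ := hxP
  have hpF := one_lt_facetFn ho hp F
  have hmF : ∀ G : Facet P, IsRidge P (F.1 ∩ G.1) →
      ridgeFn P o p (F.1 ∩ G.1) (p F - o) = 1 := fun G hG =>
    (ridgeFn_spec ho hp hG).2.2 F inter_subset_left
  set u := x - p F with hu
  have hmu : ∀ G : Facet P, IsRidge P (F.1 ∩ G.1) → ridgeFn P o p (F.1 ∩ G.1) u ≤ 0 := by
    intro G hG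
    have e : u = (x - o) - (p F - o) := by rw [hu]; abel
    rw [e, map_sub, hmF G hG]
    linarith [hx _ hG]
  have hpQ : p F ∈ convexHull ℝ (P ∪ range p) := subset_convexHull ℝ _ (Or.inr ⟨F, rfl⟩)
  have hxu : facetFn o F (x - o) = facetFn o F (p F - o) + facetFn o F u := by
    rw [← map_add]; congr 1; rw [hu]; abel
  have hval : ∀ (l : E →L[ℝ] ℝ) (s : ℝ), l (p F + s • u - o) = l (p F - o) + s * l u := by
    intro l s
    have e : p F + s • u - o = (p F - o) + s • u := by abel
    rw [e, map_add, map_smul, smul_eq_mul]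
  -- Follow the line from `p F` through `x`. If it descends towards `F`, it hits `F` at or after
  -- `x`, so `x` lies between two points of the hull. If it is parallel to `F`, a ray would lie in
  -- `F` unless `x = p F`. If it ascends, its backward prolongation hits the hyperplane of `F`
  -- weakly beyond all neighbours, which is impossible.
  rcases lt_trichotomy (facetFn o F u) 0 with hneg | hzero | hpos
  · set s := (1 - facetFn o F (p F - o)) / facetFn o F u with hs
    have hs1 : 1 ≤ s := by
      rw [hs, one_le_div_of_neg hneg]
      linarith
    have hyF : facetFn o F (p F + s • u - o) = 1 := by
      rw [hval, hs, div_mul_cancel₀ _ hneg.ne]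
      ring
    have hy : p F + s • u ∈ F.1 := by
      refine mem_facet_of_adjacent hP ho F hyF fun G hG => ?_
      obtain ⟨t, h0, h1, ht⟩ := ridgeFn_eq_comb hP ho hp hG
      have hm : ridgeFn P o p (F.1 ∩ G.1) (p F + s • u - o) ≤ 1 := by
        rw [hval, hmF G hG]
        have := mul_nonpos_of_nonneg_of_nonpos (show 0 ≤ s by linarith) (hmu G hG)
        linarith
      rw [ht, add_apply, smul_apply, smul_apply, hyF, smul_eq_mul, smul_eq_mul] at hm
      by_contra! h2
      have := mul_lt_mul_of_pos_left h2 h0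
      linarith
    have hyQ : p F + s • u ∈ convexHull ℝ (P ∪ range p) :=
      subset_convexHull ℝ _ (Or.inl (F.2.1.subset hy))
    have hs0 : s ≠ 0 := by linarith
    have e : x = (1 - 1 / s) • p F + (1 / s) • (p F + s • u) := by
      rw [smul_add, smul_smul, one_div, inv_mul_cancel₀ hs0, hu]
      module
    rw [e]
    refine convex_convexHull ℝ _ hpQ hyQ ?_ (by positivity) (by ring)
    rw [sub_nonneg, div_le_one (by linarith)]
    exact hs1
  · have hu0 : u = 0 := by
      obtain ⟨z, hz⟩ := F.2.2.1
      apply hP.eq_zero_of_forall_mem (z := z)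
      intro s hs
      have hval' : ∀ l : E →L[ℝ] ℝ, l (z + s • u - o) = l (z - o) + s * l u := by
        intro l
        have e : z + s • u - o = (z - o) + s • u := by abel
        rw [e, map_add, map_smul, smul_eq_mul]
      refine F.2.1.subset (mem_facet_of_adjacent hP ho F ?_ fun G hG => ?_)
      · rw [hval', hzero, facetFn_eq ho F hz]
        simp
      · obtain ⟨t, h0, h1, ht⟩ := ridgeFn_eq_comb hP ho hp hG
        have hm := hmu G hG
        rw [ht, add_apply, smul_apply, smul_apply, hzero, smul_eq_mul, smul_eq_mul] at hm
        have h2 : facetFn o G u ≤ 0 := by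
          by_contra! h2
          have := mul_pos h0 h2
          linarith
        rw [hval']
        have := mul_nonpos_of_nonneg_of_nonpos hs h2
        linarith [facetFn_le ho G (F.2.1.subset hz)]
    have : x = p F := sub_eq_zero.1 hu0
    rwa [this]
  · exfalso
    set s := (1 - facetFn o F (p F - o)) / facetFn o F u with hs
    have hs1 : s < 0 := div_neg_of_neg_of_pos (by linarith) hpos
    have hyF : facetFn o F (p F + s • u - o) = 1 := by
      rw [hval, hs, div_mul_cancel₀ _ hpos.ne']
      ring
    refine not_forall_adjacent_ge hP ho hd F hyF fun G hG => ?_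
    obtain ⟨t, h0, h1, ht⟩ := ridgeFn_eq_comb hP ho hp hG
    have hm : 1 ≤ ridgeFn P o p (F.1 ∩ G.1) (p F + s • u - o) := by
      rw [hval, hmF G hG]
      have := mul_nonneg_of_nonpos_of_nonpos hs1.le (hmu G hG)
      linarith
    rw [ht, add_apply, smul_apply, smul_apply, hyF, smul_eq_mul, smul_eq_mul] at hm
    by_contra! h2
    have := mul_lt_mul_of_pos_left h2 h0
    linarith

/-- Every non-empty proper face of the polytope spanned by a flat family lies on a ridge
hyperplane. -/
theorem exists_ridgeFn_eq_one (hP : IsFullPolytope P) (ho : o ∈ interior P)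
    (hd : 2 ≤ dim P) (hp : IsFlat P p) {G : Set E}
    (hG : IsExposed ℝ (convexHull ℝ (P ∪ range p)) G) (hne : G.Nonempty)
    (hGQ : G ≠ convexHull ℝ (P ∪ range p)) :
    ∃ R, IsRidge P R ∧ ∀ x ∈ G, ridgeFn P o p R (x - o) = 1 := by
  have hQ := isFullPolytope_convexHull_union_range hP p
  have hoQ : o ∈ interior (convexHull ℝ (P ∪ range p)) :=
    interior_mono (subset_union_left.trans (subset_convexHull ℝ _)) ho
  obtain ⟨k, hk, hGk⟩ := exists_touch_of_isExposed hoQ hG hne hGQ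
  obtain ⟨z, hz, hgen⟩ := hQ.exists_generic hG hne
  have hkz : k (z - o) = 1 := (hGk ▸ hz : z ∈ touch _ o k).2
  -- If every ridge inequality were slack at the generic point `z`, moving away from `o` would stay
  -- in the polytope and push `k` above one.
  by_cases hall : ∀ R, IsRidge P R → ridgeFn P o p R (z - o) < 1
  · exfalso
    have hfin : {R | IsRidge P R}.Finite := hP.finite_faces.subset fun R hR => hR.1
    have hev : ∀ᶠ ε in nhdsWithin (0 : ℝ) (Ioi 0), ∀ R ∈ {R | IsRidge P R},
        ridgeFn P o p R (z + ε • (z - o) - o) < 1 := by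
      refine Filter.Eventually.filter_mono nhdsWithin_le_nhds ?_
      rw [Filter.eventually_all_finite hfin]
      intro R hR
      have hc : Continuous (fun ε : ℝ => ridgeFn P o p R (z + ε • (z - o) - o)) := by fun_prop
      have := hc.tendsto 0
      simp only [zero_smul, add_zero] at this
      exact this.eventually (gt_mem_nhds (hall R hR))
    obtain ⟨ε, hε, hε0⟩ := (hev.and self_mem_nhdsWithin).exists
    have hε0' : 0 < ε := hε0
    have := hk _ (mem_convexHull_of_ridgeFn_le hP ho hd hp fun R hR => (hε R hR).le)
    have e : z + ε • (z - o) - o = (z - o) + ε • (z - o) := by abel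
    rw [e, map_add, map_smul, hkz, smul_eq_mul] at this
    linarith
  · push Not at hall
    obtain ⟨R, hR, hRz⟩ := hall
    have hm := ridgeFn_mem_polarAt hP ho hp hR
    refine ⟨R, hR, fun x hx => ?_⟩
    have := hgen (ridgeFn P o p R) (1 + ridgeFn P o p R o) (fun y hy => by
      have := hm y (hG.subset hy)
      rw [map_sub] at this
      linarith) (by
        have h1 := hm z (hG.subset hz)
        rw [map_sub] at h1 hRz
        linarith) x hx
    rw [map_sub]
    linarith

end FacesOfFlat

/-! ### Flat families are the vertex-preserving realisations -/

section Realisations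

variable {E : Type*} [NormedAddCommGroup E] [NormedSpace ℝ E]

/-- The family `p` of points beyond the facets of `P` spans a vertex-preserving realisation of
`E(P)`. -/
def Realises (P : Set E) (p : Facet P → E) : Prop :=
  (∀ F : Facet P, IsBeyond P F.1 (p F)) ∧
    ∃ Φ : EPoset P ≃o Face (convexHull ℝ (P ∪ range p)),
      ∀ c : EPoset P, (Φ c).1 = convexHull ℝ (c.1.1.1 ∪ p '' c.1.2)

theorem isVertexPreservingRealisation_iff_exists_realises {P Q : Set E} :
    IsVertexPreservingRealisation P Q ↔
      ∃ p : Facet P → E, Realises P p ∧ Q = convexHull ℝ (P ∪ range p) := by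
  constructor
  · rintro ⟨p, h1, rfl, h2⟩
    exact ⟨p, ⟨h1, h2⟩, rfl⟩
  · rintro ⟨p, ⟨h1, h2⟩, rfl⟩
    exact ⟨p, h1, rfl, h2⟩

theorem isExposed_of_le {A : Set E} {l : E →L[ℝ] ℝ} {c : ℝ} (h : ∀ x ∈ A, l x ≤ c) :
    IsExposed ℝ A {x ∈ A | l x = c} := by
  rintro ⟨x0, hx0, h0⟩
  refine ⟨l, ?_⟩
  ext x
  exact ⟨fun hx => ⟨hx.1, fun y hy => hx.2 ▸ h y hy⟩,
    fun hx => ⟨hx.1, le_antisymm (h x hx.1) (h0 ▸ hx.2 x0 hx0)⟩⟩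

variable {P : Set E} {o : E} {p : Facet P → E}

/-- The cells of `E(P)` realise its face poset as soon as they are exactly the faces of the
polytope they span and each can be recovered from its hull. -/
theorem realises_of_cells (hbeyond : ∀ F : Facet P, IsBeyond P F.1 (p F))
    (hexp : ∀ c ∈ EPoset P, IsExposed ℝ (convexHull ℝ (P ∪ range p))
      (convexHull ℝ (c.1.1 ∪ p '' c.2)))
    (hsurj : ∀ G, IsExposed ℝ (convexHull ℝ (P ∪ range p)) G →
      ∃ c ∈ EPoset P, convexHull ℝ (c.1.1 ∪ p '' c.2) = G)
    (hface : ∀ c ∈ EPoset P, convexHull ℝ (c.1.1 ∪ p '' c.2) ∩ P ⊆ c.1.1)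
    (hnew : ∀ c ∈ EPoset P, ∀ F, p F ∈ convexHull ℝ (c.1.1 ∪ p '' c.2) → F ∈ c.2) :
    Realises P p := by
  refine ⟨hbeyond, ?_⟩
  let f : EPoset P → Face (convexHull ℝ (P ∪ range p)) := fun c =>
    ⟨convexHull ℝ (c.1.1.1 ∪ p '' c.1.2), hexp c.1 c.2⟩
  have hle : ∀ c c' : EPoset P, f c ≤ f c' ↔ c ≤ c' := by
    intro c c'
    constructor
    · intro h
      have h' : convexHull ℝ (c.1.1.1 ∪ p '' c.1.2) ⊆ convexHull ℝ (c'.1.1.1 ∪ p '' c'.1.2) := h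
      refine ⟨fun x hx => hface c'.1 c'.2 ⟨h' (subset_convexHull ℝ _ (Or.inl hx)),
        c.1.1.2.subset hx⟩, fun F hF => hnew c'.1 c'.2 F (h' (subset_convexHull ℝ _ ?_))⟩
      exact Or.inr ⟨F, hF, rfl⟩
    · rintro ⟨h1, h2⟩
      exact convexHull_mono (union_subset_union h1 (image_mono h2))
  let g : EPoset P ↪o Face (convexHull ℝ (P ∪ range p)) := OrderEmbedding.ofMapLEIff f hle
  have hs : Function.Surjective g := by
    rintro ⟨G, hG⟩
    obtain ⟨c, hc, h⟩ := hsurj G hG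
    exact ⟨⟨c, hc⟩, Subtype.ext h⟩
  exact ⟨RelIso.ofSurjective g hs, fun c => rfl⟩

theorem face_eq_convexHull_cell {B : Set E} (hB : IsExposed ℝ (convexHull ℝ (P ∪ range p)) B) :
    B = convexHull ℝ (B ∩ P ∪ p '' {F | p F ∈ B}) := by
  conv_lhs => rw [exposed_eq_convexHull hB]
  congr 1
  ext x
  constructor
  · rintro ⟨hx, hx' | ⟨F, rfl⟩⟩
    · exact Or.inl ⟨hx, hx'⟩
    · exact Or.inr ⟨F, hx, rfl⟩
  · rintro (hx | ⟨F, hF, rfl⟩)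
    · exact ⟨hx.1, Or.inl hx.2⟩
    · exact ⟨hF, Or.inr ⟨F, rfl⟩⟩

theorem mem_interior_convexHull_union (ho : o ∈ interior P) (p : Facet P → E) :
    o ∈ interior (convexHull ℝ (P ∪ range p)) :=
  interior_mono (subset_union_left.trans (subset_convexHull ℝ _)) ho

theorem isExposed_inter_left {A : Set E} (hPA : P ⊆ A) (ho : o ∈ interior P) {G : Set E}
    (hG : IsExposed ℝ A G) (hGA : G ≠ A) : IsExposed ℝ P (G ∩ P) := by
  rcases G.eq_empty_or_nonempty with rfl | hne
  · rw [empty_inter]; exact isExposed_empty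
  obtain ⟨k, hk, hGk⟩ := exists_touch_of_isExposed (interior_mono hPA ho) hG hne hGA
  have hkP : k ∈ polarAt P o := fun x hx => hk x (hPA hx)
  have : G ∩ P = touch P o k := by
    ext x
    constructor
    · rintro ⟨h1, h2⟩
      exact ⟨h2, (hGk ▸ h1 : x ∈ touch A o k).2⟩
    · rintro ⟨h1, h2⟩
      exact ⟨hGk ▸ (⟨hPA h1, h2⟩ : x ∈ touch A o k), h1⟩
  rw [this]
  exact touch_isExposed hkP

theorem IsLow.eq_empty_of_dim_le_one {x : Set E} (hd : dim P ≤ 1) (hx : IsLow P x) : x = ∅ := by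
  rcases hx with h | h
  · exact h
  · omega

/-- The cell of a ridge differs from the top cell, so its image is a proper face of the hull; the
functional exposing it supplies the required hyperplane. -/
theorem Realises.isFlat (hP : IsFullPolytope P) (hp : Realises P p) : IsFlat P p := by
  obtain ⟨o, ho⟩ := hP.2
  obtain ⟨hb, Φ, hΦ⟩ := hp
  refine ⟨hb, fun R hR => ?_⟩
  have hoQ := mem_interior_convexHull_union ho p
  let c : EPoset P := ⟨(⟨R, hR.1⟩, {F | R ⊆ F.1}), Or.inr (Or.inr (Or.inl ⟨hR, rfl⟩))⟩
  let t : EPoset P := ⟨(⟨P, IsExposed.refl P⟩, univ), Or.inr (Or.inr (Or.inr ⟨rfl, rfl⟩))⟩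
  have hct : c ≠ t := by
    intro h
    have : R = P := congrArg (fun e : EPoset P => e.1.1.1) h
    exact ridge_ne hR this
  have ht : (Φ t).1 = convexHull ℝ (P ∪ range p) := by rw [hΦ]; simp [t]
  have hc : (Φ c).1 = convexHull ℝ (R ∪ p '' {F | R ⊆ F.1}) := hΦ c
  have hne : (Φ c).1 ≠ convexHull ℝ (P ∪ range p) := fun h =>
    hct (Φ.injective (Subtype.ext (h.trans ht.symm)))
  have hsub := subset_convexHull ℝ (R ∪ p '' {F | R ⊆ F.1})
  rw [← hc] at hsub
  have hRc : R ⊆ (Φ c).1 := subset_union_left.trans hsub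
  obtain ⟨k, hk, hck⟩ := exists_touch_of_isExposed hoQ (Φ c).2 (hR.2.1.mono hRc) hne
  have hk1 : ∀ x ∈ (Φ c).1, k x = 1 + k o := fun x hx => by
    have : k (x - o) = 1 := (hck ▸ hx : x ∈ touch _ o k).2
    rw [map_sub] at this
    linarith
  refine ⟨k, 1 + k o, ?_, ?_, fun x hx => hk1 x (hRc hx),
    fun F hF => hk1 _ (hsub (Or.inr ⟨F, hF, rfl⟩))⟩
  · rintro rfl
    obtain ⟨x, hx⟩ := hR.2.1
    simpa using hk1 x (hRc hx)
  · intro x hx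
    have := hk x (subset_convexHull ℝ _ (Or.inl hx))
    rw [map_sub] at this
    linarith

variable [FiniteDimensional ℝ E]

/-- With equal spans, the functionals exposing the two faces would agree on the larger one, so the
faces would coincide. -/
theorem dim_lt_of_ssubset (ho : o ∈ interior P) {x R : Set E} (hx : IsExposed ℝ P x)
    (hR : IsExposed ℝ P R) (hRP : R ≠ P) (hne : x.Nonempty) (hxR : x ⊆ R) (hne' : x ≠ R) :
    dim x < dim R := by
  have hxP : x ≠ P := fun h => hne' (Subset.antisymm hxR (h ▸ hR.subset))
  obtain ⟨k, hk, hxk⟩ := exists_touch_of_isExposed ho hx hne hxP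
  obtain ⟨m, hm, hRm⟩ := exists_touch_of_isExposed ho hR (hne.mono hxR) hRP
  have h1 : ∀ y ∈ x, k (y - o) = 1 := fun y hy => (hxk ▸ hy : y ∈ touch P o k).2
  have h2 : ∀ y ∈ R, m (y - o) = 1 := fun y hy => (hRm ▸ hy : y ∈ touch P o m).2
  have e1 := finrank_relSpan hne h1
  have e2 := finrank_relSpan (hne.mono hxR) h2
  have hmono := relSpan_mono (o := o) hxR
  have hle := Submodule.finrank_mono hmono
  by_contra! hlt
  have heq : relSpan o x = relSpan o R := Submodule.eq_of_le_of_finrank_le hmono (by omega)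
  refine hne' (Subset.antisymm hxR fun y hy => ?_)
  have h3 : k (y - o) = m (y - o) :=
    eq_on_relSpan (F := x) (fun z hz => by rw [h1 z hz, h2 z (hxR hz)])
      (heq ▸ sub_mem_relSpan hy)
  rw [hxk]
  exact ⟨hR.subset hy, by rw [h3, h2 y hy]⟩

theorem notMem_of_isFlat (ho : o ∈ interior P) (hp : IsFlat P p) (F : Facet P) : p F ∉ P :=
  fun h => by linarith [one_lt_facetFn ho hp F, facetFn_le ho F h]

/-- The functional of `F` exceeds one at `p F` and is at most one at all other generators. -/
theorem isExposed_singleton (hP : IsFullPolytope P) (ho : o ∈ interior P) (hp : IsFlat P p)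
    (F : Facet P) : IsExposed ℝ (convexHull ℝ (P ∪ range p)) {p F} := by
  have hle : ∀ x ∈ P ∪ range p, facetFn o F x ≤ facetFn o F (p F) ∧
      (facetFn o F x = facetFn o F (p F) → x = p F) := by
    have h1 := one_lt_facetFn ho hp F
    rw [map_sub] at h1
    rintro x (hx | ⟨G, rfl⟩)
    · have := facetFn_le ho F hx
      rw [map_sub] at this
      exact ⟨by linarith, fun h => by linarith⟩
    · by_cases hG : G = F
      · exact ⟨by rw [hG], fun _ => by rw [hG]⟩
      · have := facetFn_lt_one_of_ne hP ho hp (Ne.symm hG)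
        rw [map_sub] at this
        exact ⟨by linarith, fun h => by linarith⟩
  have h1 := convexHull_inter_of_le fun x hx => (hle x hx).1
  have h2 : {x ∈ P ∪ range p | facetFn o F x = facetFn o F (p F)} = {p F} := by
    ext x
    constructor
    · exact fun hx => (hle x hx.1).2 hx.2
    · rintro rfl
      exact ⟨Or.inr ⟨F, rfl⟩, rfl⟩
  rw [h2, convexHull_singleton] at h1
  rw [← h1]
  exact isExposed_of_le fun x hx => le_of_mem_convexHull (fun x hx => (hle x hx).1) hx

theorem mem_of_mem_convexHull_cell (hP : IsFullPolytope P) (ho : o ∈ interior P)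
    (hp : IsFlat P p) {x : Set E} (hx : x ⊆ P) {A : Set (Facet P)} {F : Facet P}
    (hF : p F ∈ convexHull ℝ (x ∪ p '' A)) : F ∈ A := by
  by_contra hFA
  have := le_of_mem_convexHull (l := facetFn o F) (c := 1 + facetFn o F o) (fun y hy => by
    have : facetFn o F (y - o) ≤ 1 := by
      rcases hy with hy | ⟨G, hG, rfl⟩
      · exact facetFn_le ho F (hx hy)
      · refine (facetFn_lt_one_of_ne hP ho hp ?_).le
        rintro rfl
        exact hFA hG
    rw [map_sub] at this
    linarith) hF
  have h1 := one_lt_facetFn ho hp F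
  rw [map_sub] at h1
  linarith

theorem convexHull_cell_inter_subset (hP : IsFullPolytope P) (ho : o ∈ interior P)
    (hp : IsFlat P p) {c : Face P × Set (Facet P)} (hc : c ∈ EPoset P) :
    convexHull ℝ (c.1.1 ∪ p '' c.2) ∩ P ⊆ c.1.1 := by
  obtain ⟨⟨x, hx⟩, A⟩ := c
  simp only
  rcases hc with ⟨-, hA⟩ | ⟨F, -, hxF, hA⟩ | ⟨hR, hA⟩ | ⟨hxP, -⟩
  · simp only at hA
    subst hA
    rw [image_empty, union_empty, (hx.convex hP.convex).convexHull_eq]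
    exact inter_subset_left
  · simp only at hA hxF
    subst hA
    rw [image_singleton]
    rintro q ⟨hq, hqP⟩
    -- The cell lies on the far side of the hyperplane of `F` and `P` on the near side, so they meet
    -- only in that hyperplane, where the cell reduces to `x`.
    have hge : ∀ y ∈ x ∪ {p F}, (-facetFn o F) y ≤ -(1 + facetFn o F o) := by
      rintro y (hy | rfl)
      · have := facetFn_eq ho F (hxF hy)
        rw [map_sub] at this
        rw [neg_apply]
        linarith
      · have := one_lt_facetFn ho hp F
        rw [map_sub] at this
        rw [neg_apply]
        linarith
    have h1 := convexHull_inter_of_le hge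
    have h2 : {y ∈ x ∪ {p F} | (-facetFn o F) y = -(1 + facetFn o F o)} ⊆ x := by
      rintro y ⟨hy | rfl, h⟩
      · exact hy
      · have := one_lt_facetFn ho hp F
        rw [map_sub] at this
        rw [neg_apply] at h
        linarith
    have h3 := convexHull_mono (𝕜 := ℝ) h2
    rw [← h1, (hx.convex hP.convex).convexHull_eq] at h3
    refine h3 ⟨hq, le_antisymm (le_of_mem_convexHull hge hq) ?_⟩
    have := facetFn_le ho F hqP
    rw [map_sub] at this
    rw [neg_apply]
    linarith
  · simp only at hA hR
    rintro q ⟨hq, hqP⟩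
    have hs := ridgeFn_spec ho hp hR
    have hall : ∀ y ∈ x ∪ p '' A, ridgeFn P o p x (y - o) = 1 := by
      rintro y (hy | ⟨F, hF, rfl⟩)
      · exact hs.2.1 y hy
      · subst hA
        exact hs.2.2 F hF
    rw [mem_ridge_iff hP ho hp hR hqP]
    refine le_antisymm (hs.1 q hqP) ?_
    have := le_of_mem_convexHull (l := -ridgeFn P o p x) (c := -(1 + ridgeFn P o p x o))
      (fun y hy => by
        have := hall y hy
        rw [map_sub] at this
        rw [neg_apply]
        linarith) hq
    rw [neg_apply] at this
    rw [map_sub]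
    linarith
  · simp only at hxP
    rw [hxP]
    exact inter_subset_right

/-- A set of ridges determines a face of the polytope spanned by a flat family. -/
theorem isExposed_convexHull_of_ridges (hP : IsFullPolytope P) (ho : o ∈ interior P)
    (hp : IsFlat P p) {S : Set (Set E)} (hS : ∀ R ∈ S, IsRidge P R) (hne : S.Nonempty) :
    IsExposed ℝ (convexHull ℝ (P ∪ range p))
      (convexHull ℝ ({q ∈ P | ∀ R ∈ S, q ∈ R} ∪ p '' {F | ∀ R ∈ S, R ⊆ F.1})) := by
  set Q := convexHull ℝ (P ∪ range p) with hQ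
  have hfin : S.Finite := hP.finite_faces.subset fun R hR => (hS R hR).1
  have hfin' := hfin.image fun R => touch Q o (ridgeFn P o p R)
  -- The face is the intersection of the faces on the hyperplanes of the ridges in `S`; finiteness
  -- and non-emptiness of `S` make this intersection exposed.
  have hB : IsExposed ℝ Q (⋂₀ (hfin'.toFinset : Set (Set E))) := by
    apply IsExposed.sInter
    · simpa using hne
    · intro B hB
      rw [Finite.mem_toFinset] at hB
      obtain ⟨R, hR, rfl⟩ := hB
      exact touch_isExposed (ridgeFn_mem_polarAt hP ho hp (hS R hR))
  rw [Finite.coe_toFinset] at hB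
  have hmem : ∀ q ∈ Q, (q ∈ ⋂₀ ((fun R => touch Q o (ridgeFn P o p R)) '' S) ↔
      ∀ R ∈ S, ridgeFn P o p R (q - o) = 1) := by
    intro q hq
    rw [mem_sInter]
    constructor
    · intro h R hR
      exact (h _ ⟨R, hR, rfl⟩).2
    · rintro h _ ⟨R, hR, rfl⟩
      exact ⟨hq, h R hR⟩
  have hPQ : ∀ q ∈ P, q ∈ Q := fun q hq => subset_convexHull ℝ _ (Or.inl hq)
  have hpQ : ∀ F, p F ∈ Q := fun F => subset_convexHull ℝ _ (Or.inr ⟨F, rfl⟩)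
  have heq := face_eq_convexHull_cell hB
  have e1 : ⋂₀ ((fun R => touch Q o (ridgeFn P o p R)) '' S) ∩ P = {q ∈ P | ∀ R ∈ S, q ∈ R} := by
    ext q
    constructor
    · rintro ⟨h1, h2⟩
      exact ⟨h2, fun R hR => (mem_ridge_iff hP ho hp (hS R hR) h2).2 ((hmem q (hPQ q h2)).1 h1 R hR)⟩
    · rintro ⟨h2, h1⟩
      exact ⟨(hmem q (hPQ q h2)).2 fun R hR => (mem_ridge_iff hP ho hp (hS R hR) h2).1 (h1 R hR), h2⟩
  have e2 : {F | p F ∈ ⋂₀ ((fun R => touch Q o (ridgeFn P o p R)) '' S)} =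
      {F | ∀ R ∈ S, R ⊆ F.1} := by
    ext F
    constructor
    · intro h R hR
      exact (ridgeFn_le_one hP ho hp (hS R hR) F).2 ((hmem _ (hpQ F)).1 h R hR)
    · intro h
      exact (hmem _ (hpQ F)).2 fun R hR => (ridgeFn_spec ho hp (hS R hR)).2.2 F (h R hR)
  rw [e1, e2] at heq
  rwa [← heq]

/-- Each proper non-empty cell is cut out by suitable ridges: all ridges containing `x` for `(x,
∅)`, only those between `F` and a facet through `x` for `(x, {F})`, and the ridge alone for a ridge
cell. -/
theorem isExposed_convexHull_cell (hP : IsFullPolytope P) (ho : o ∈ interior P)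
    (hd : 2 ≤ dim P) (hp : IsFlat P p) {c : Face P × Set (Facet P)} (hc : c ∈ EPoset P) :
    IsExposed ℝ (convexHull ℝ (P ∪ range p)) (convexHull ℝ (c.1.1 ∪ p '' c.2)) := by
  obtain ⟨⟨x, hx⟩, A⟩ := c
  simp only
  rcases hc with ⟨hlow, hA⟩ | ⟨F, hlow, hxF, hA⟩ | ⟨hR, hA⟩ | ⟨hxP, hA⟩
  · simp only at hA hlow
    subst hA
    rcases x.eq_empty_or_nonempty with rfl | hne
    · simpa using isExposed_empty
    have hxP : x ≠ P := by
      rintro rfl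
      rcases hlow with rfl | h
      · simp at hne
      · omega
    obtain ⟨F, hxF⟩ := exists_facet_superset hP ho hx hne hxP
    have key := isExposed_convexHull_of_ridges hP ho hp (S := {R | IsRidge P R ∧ x ⊆ R})
      (fun R hR => hR.1) (by
        obtain ⟨G, -, h1, h2⟩ := hlow.exists_adjacent_ne hP ho hd hx F hxF F
        exact ⟨_, h1, subset_inter hxF h2⟩)
    have e1 : {q ∈ P | ∀ R ∈ {R | IsRidge P R ∧ x ⊆ R}, q ∈ R} = x := by
      ext q
      constructor
      · rintro ⟨-, h⟩
        obtain ⟨G, -, h1, h2⟩ := hlow.exists_adjacent_ne hP ho hd hx F hxF F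
        refine IsLow.mem_of_adjacent hP ho hd hx F hxF
          (h _ ⟨h1, subset_inter hxF h2⟩).1 fun G' h3 h4 => (h _ ⟨h3, subset_inter hxF h4⟩).2
      · exact fun hq => ⟨hx.subset hq, fun R hR => hR.2 hq⟩
    -- A facet `H` containing all these ridges would be `F`, by a neighbour `G ≠ H` of `F` through
    -- `x`; a second neighbour `G' ≠ H` of `G` through `x` excludes this.
    have e2 : {H : Facet P | ∀ R ∈ {R | IsRidge P R ∧ x ⊆ R}, R ⊆ H.1} = ∅ := by
      rw [eq_empty_iff_forall_notMem]
      intro H h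
      obtain ⟨G, hGH, h1, h2⟩ := hlow.exists_adjacent_ne hP ho hd hx F hxF H
      rcases eq_or_eq_of_isRidge_inter hP ho h1 (h _ ⟨h1, subset_inter hxF h2⟩) with rfl | rfl
      · obtain ⟨G', hGH', h1', h2'⟩ := hlow.exists_adjacent_ne hP ho hd hx G h2 H
        rcases eq_or_eq_of_isRidge_inter hP ho h1' (h _ ⟨h1', subset_inter h2 h2'⟩) with h' | h'
        · exact hGH h'.symm
        · exact hGH' h'.symm
      · exact hGH rfl
    rwa [e1, e2] at key
  · simp only at hA hlow hxF
    subst hA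
    have key := isExposed_convexHull_of_ridges hP ho hp
      (S := {R | IsRidge P R ∧ ∃ G : Facet P, x ⊆ G.1 ∧ R = F.1 ∩ G.1}) (fun R hR => hR.1) (by
        obtain ⟨G, -, h1, h2⟩ := hlow.exists_adjacent_ne hP ho hd hx F hxF F
        exact ⟨_, h1, G, h2, rfl⟩)
    have e1 : {q ∈ P | ∀ R ∈ {R | IsRidge P R ∧ ∃ G : Facet P, x ⊆ G.1 ∧ R = F.1 ∩ G.1}, q ∈ R}
        = x := by
      ext q
      constructor
      · rintro ⟨-, h⟩
        obtain ⟨G, -, h1, h2⟩ := hlow.exists_adjacent_ne hP ho hd hx F hxF F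
        exact IsLow.mem_of_adjacent hP ho hd hx F hxF
          (h _ ⟨h1, G, h2, rfl⟩).1 fun G' h3 h4 => (h _ ⟨h3, G', h4, rfl⟩).2
      · refine fun hq => ⟨hx.subset hq, ?_⟩
        rintro R ⟨-, G, hG, rfl⟩
        exact ⟨hxF hq, hG hq⟩
    have e2 : {H : Facet P | ∀ R ∈ {R | IsRidge P R ∧ ∃ G : Facet P, x ⊆ G.1 ∧ R = F.1 ∩ G.1},
        R ⊆ H.1} = {F} := by
      ext H
      constructor
      · intro h
        obtain ⟨G, hGH, h1, h2⟩ := hlow.exists_adjacent_ne hP ho hd hx F hxF H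
        rcases eq_or_eq_of_isRidge_inter hP ho h1 (h _ ⟨h1, G, h2, rfl⟩) with rfl | rfl
        · rfl
        · exact absurd rfl hGH
      · rintro rfl R ⟨-, G, -, rfl⟩
        exact inter_subset_left
    rwa [e1, e2] at key
  · simp only at hA hR
    subst hA
    have key := isExposed_convexHull_of_ridges hP ho hp (S := {x}) (by rintro R rfl; exact hR)
      (singleton_nonempty x)
    have e1 : {q ∈ P | ∀ R ∈ ({x} : Set (Set E)), q ∈ R} = x := by
      ext q
      exact ⟨fun h => h.2 x rfl, fun h => ⟨hx.subset h, by rintro R rfl; exact h⟩⟩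
    have e2 : {H : Facet P | ∀ R ∈ ({x} : Set (Set E)), R ⊆ H.1} = {F | x ⊆ F.1} := by
      ext H
      exact ⟨fun h => h x rfl, by rintro h R rfl; exact h⟩
    rwa [e1, e2] at key
  · simp only at hA hxP
    subst hA
    subst hxP
    rw [image_univ]

/-- A proper face lies on the hyperplane of a ridge `F ∩ H`, so only `p F` and `p H` can be its new
points. The relative interior point `r` of the ridge decides the type: it is in the face exactly
when both are, and then the cell is the ridge cell. Otherwise the old part is a proper face of the
ridge, hence low, and at most one new point occurs. -/
theorem exists_cell_eq (hP : IsFullPolytope P) (ho : o ∈ interior P)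
    (hd : 2 ≤ dim P) (hp : IsFlat P p) {G : Set E}
    (hG : IsExposed ℝ (convexHull ℝ (P ∪ range p)) G) (hne : G.Nonempty)
    (hGQ : G ≠ convexHull ℝ (P ∪ range p)) :
    ∃ c ∈ EPoset P, convexHull ℝ (c.1.1 ∪ p '' c.2) = G := by
  obtain ⟨R, hR, hRG⟩ := exists_ridgeFn_eq_one hP ho hd hp hG hne hGQ
  obtain ⟨F, H, rfl⟩ := exists_facets_inter_of_isRidge hP ho hR
  have hx : IsExposed ℝ P (G ∩ P) :=
    isExposed_inter_left (subset_union_left.trans (subset_convexHull ℝ _)) ho hG hGQ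
  have hcell := (face_eq_convexHull_cell hG).symm
  have hpQ : ∀ F, p F ∈ convexHull ℝ (P ∪ range p) := fun F =>
    subset_convexHull ℝ _ (Or.inr ⟨F, rfl⟩)
  have hxR : G ∩ P ⊆ F.1 ∩ H.1 := fun q hq => (mem_ridge_iff hP ho hp hR hq.2).2 (hRG q hq.1)
  have hA : ∀ K, p K ∈ G → K = F ∨ K = H := fun K hK =>
    eq_or_eq_of_isRidge_inter hP ho hR ((ridgeFn_le_one hP ho hp hR K).2 (hRG _ hK))
  obtain ⟨r, hr, hrR, hrx⟩ := exists_mem_openSegment_ridge hP ho hp hR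
  have hrP : r ∈ P := F.2.1.subset hrR.1
  have hiff : r ∈ G ↔ p F ∈ G ∧ p H ∈ G := by
    constructor
    · intro h
      exact ⟨hG.isExtreme.left_mem_of_mem_openSegment (hpQ F) (hpQ H) h hr,
        hG.isExtreme.right_mem_of_mem_openSegment (hpQ F) (hpQ H) h hr⟩
    · rintro ⟨h1, h2⟩
      exact (hG.convex (convex_convexHull ℝ _)).openSegment_subset h1 h2 hr
  refine ⟨(⟨G ∩ P, hx⟩, {F | p F ∈ G}), ?_, hcell⟩
  by_cases hrG : r ∈ G
  · have hRx : G ∩ P = F.1 ∩ H.1 := Subset.antisymm hxR (hrx _ hx ⟨hrG, hrP⟩)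
    right; right; left
    refine ⟨by simpa only [hRx] using hR, ?_⟩
    ext K
    simp only [hRx]
    constructor
    · intro hK
      rcases hA K hK with rfl | rfl
      · exact inter_subset_left
      · exact inter_subset_right
    · intro hK
      rcases eq_or_eq_of_isRidge_inter hP ho hR hK with rfl | rfl
      · exact (hiff.1 hrG).1
      · exact (hiff.1 hrG).2
  · have hlow : IsLow P (G ∩ P) := by
      rcases (G ∩ P).eq_empty_or_nonempty with h | h
      · exact Or.inl h
      · right
        have h1 := dim_lt_of_ssubset ho hx hR.1 (ridge_ne hR) h hxR
          (fun heq => hrG (heq ▸ hrR : r ∈ G ∩ P).1)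
        have h2 := hR.2.2
        omega
    by_cases hF : p F ∈ G
    · have hH : p H ∉ G := fun h => hrG (hiff.2 ⟨hF, h⟩)
      right; left
      refine ⟨F, hlow, hxR.trans inter_subset_left, ?_⟩
      ext K
      constructor
      · intro hK
        rcases hA K hK with rfl | rfl
        · rfl
        · exact absurd hK hH
      · rintro rfl
        exact hF
    · by_cases hH : p H ∈ G
      · right; left
        refine ⟨H, hlow, hxR.trans inter_subset_right, ?_⟩
        ext K
        constructor
        · intro hK
          rcases hA K hK with rfl | rfl
          · exact absurd hK hF
          · rfl
        · rintro rfl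
          exact hH
      · left
        refine ⟨hlow, ?_⟩
        rw [eq_empty_iff_forall_notMem]
        intro K hK
        rcases hA K hK with rfl | rfl
        · exact hF hK
        · exact hH hK

theorem isExposed_convexHull_cell_of_dim_le_one (hP : IsFullPolytope P) (ho : o ∈ interior P)
    (hd : dim P ≤ 1) (hp : IsFlat P p) {c : Face P × Set (Facet P)} (hc : c ∈ EPoset P) :
    IsExposed ℝ (convexHull ℝ (P ∪ range p)) (convexHull ℝ (c.1.1 ∪ p '' c.2)) := by
  rcases hc with ⟨hx, hA⟩ | ⟨F, hx, -, hA⟩ | ⟨hR, -⟩ | ⟨hx, hA⟩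
  · rw [hx.eq_empty_of_dim_le_one hd, hA]
    simpa using isExposed_empty
  · rw [hx.eq_empty_of_dim_le_one hd, hA]
    simpa using isExposed_singleton hP ho hp F
  · have := hR.2.2
    omega
  · rw [hx, hA, image_univ]

/-- A proper face is a single generator. It cannot be a point of `P`, since then its functional
would be that of a facet and violated by the point beyond it. -/
theorem exists_cell_eq_of_dim_le_one (hP : IsFullPolytope P) (ho : o ∈ interior P)
    (hd : dim P ≤ 1) (hp : IsFlat P p) {G : Set E}
    (hG : IsExposed ℝ (convexHull ℝ (P ∪ range p)) G) (hne : G.Nonempty)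
    (hGQ : G ≠ convexHull ℝ (P ∪ range p)) :
    ∃ c ∈ EPoset P, convexHull ℝ (c.1.1 ∪ p '' c.2) = G := by
  have hd' : Module.finrank ℝ E ≤ 1 := by rwa [← dim_eq_finrank ⟨o, ho⟩]
  have hoQ := mem_interior_convexHull_union ho p
  obtain ⟨k, hk, hGk⟩ := exists_touch_of_isExposed hoQ hG hne hGQ
  have hne' : (G ∩ (P ∪ range p)).Nonempty := by
    rw [exposed_eq_convexHull hG] at hne
    exact convexHull_nonempty_iff.1 hne
  obtain ⟨w, hwG, hw⟩ := hne'
  have hk1 : ∀ x ∈ G, k (x - o) = 1 := fun x hx => (hGk ▸ hx : x ∈ touch _ o k).2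
  have hk0 : k ≠ 0 := by
    rintro rfl
    simpa using hk1 w hwG
  have hGw : G = {w} := by
    refine Subset.antisymm (fun x hx => ?_) (singleton_subset_iff.2 hwG)
    have : x - w = 0 := exists_finrank_le_one hd' hk0 (by
      have h1 := hk1 x hx
      have h2 := hk1 w hwG
      rw [map_sub] at h1 h2 ⊢
      linarith)
    exact sub_eq_zero.1 this
  have hkP : k ∈ polarAt P o := fun x hx => hk x (subset_convexHull ℝ _ (Or.inl hx))
  rcases hw with hwP | ⟨F, rfl⟩
  · exfalso
    have hkw := hk1 w hwG
    obtain ⟨F, hF⟩ := exists_facetFn_ge hP ho hkP (v := w - o) (by rw [hkw]; norm_num)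
    have hFw : facetFn o F (w - o) = 1 := le_antisymm (facetFn_le ho F hwP) (hkw ▸ hF)
    have hw0 : w - o ≠ 0 := by
      intro h
      rw [h] at hkw
      simp at hkw
    have heq : k - facetFn o F = 0 := by
      by_contra hne0
      exact hw0 (exists_finrank_le_one hd' hne0 (by rw [sub_apply, hkw, hFw, sub_self]))
    have h1 := hk (p F) (subset_convexHull ℝ _ (Or.inr ⟨F, rfl⟩))
    rw [sub_eq_zero.1 heq] at h1
    linarith [one_lt_facetFn ho hp F]
  · exact ⟨(⟨∅, isExposed_empty⟩, {F}), Or.inr (Or.inl ⟨F, Or.inl rfl, empty_subset _, rfl⟩),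
      by simp [hGw]⟩

theorem IsFlat.realises (hP : IsFullPolytope P) (hp : IsFlat P p) : Realises P p := by
  obtain ⟨o, ho⟩ := hP.2
  refine realises_of_cells hp.1 ?_ ?_ (fun c hc => convexHull_cell_inter_subset hP ho hp hc)
    (fun c _ F hF => mem_of_mem_convexHull_cell hP ho hp c.1.2.subset hF)
  · intro c hc
    rcases le_or_gt 2 (dim P) with hd | hd
    · exact isExposed_convexHull_cell hP ho hd hp hc
    · exact isExposed_convexHull_cell_of_dim_le_one hP ho (by omega) hp hc
  · intro G hG
    rcases G.eq_empty_or_nonempty with rfl | hne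
    · exact ⟨(⟨∅, isExposed_empty⟩, ∅), Or.inl ⟨Or.inl rfl, rfl⟩, by simp⟩
    by_cases hGQ : G = convexHull ℝ (P ∪ range p)
    · exact ⟨(⟨P, IsExposed.refl P⟩, univ), Or.inr (Or.inr (Or.inr ⟨rfl, rfl⟩)),
        by simp [hGQ]⟩
    rcases le_or_gt 2 (dim P) with hd | hd
    · exact exists_cell_eq hP ho hd hp hG hne hGQ
    · exact exists_cell_eq_of_dim_le_one hP ho (by omega) hp hG hne hGQ

/-- Vertex-preserving realisations of `E(P)` are spanned by the flat families of points. -/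
theorem isVertexPreservingRealisation_iff (hP : IsFullPolytope P) {Q : Set E} :
    IsVertexPreservingRealisation P Q ↔
      ∃ p : Facet P → E, IsFlat P p ∧ Q = convexHull ℝ (P ∪ range p) := by
  rw [isVertexPreservingRealisation_iff_exists_realises]
  exact exists_congr fun p => and_congr_left fun _ =>
    ⟨fun h => h.isFlat hP, fun h => h.realises hP⟩

/-- An extreme point of the hull lying in `P` is extreme in `P`; each `p F` is an exposed point
outside `P`. -/
theorem newVertices_eq (hP : IsFullPolytope P) (hp : IsFlat P p) :
    newVertices P (convexHull ℝ (P ∪ range p)) = range p := by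
  obtain ⟨o, ho⟩ := hP.2
  ext q
  constructor
  · rintro ⟨h1, h2⟩
    rcases extremePoints_convexHull_subset h1 with hq | hq
    · exact absurd (inter_extremePoints_subset_extremePoints_of_subset
        (subset_union_left.trans (subset_convexHull ℝ _)) ⟨hq, h1⟩) h2
    · exact hq
  · rintro ⟨F, rfl⟩
    exact ⟨isExtreme_singleton.1 (isExposed_singleton hP ho hp F).isExtreme,
      fun h => notMem_of_isFlat ho hp F (extremePoints_subset h)⟩

end Realisations

/-! ### Fractions of segments in terms of facet functionals -/

section Fractions

variable {E : Type*} [NormedAddCommGroup E] [NormedSpace ℝ E] {P : Set E} {o : E} {p : Facet P → E}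

theorem IsFullPolytope.convexHull_extremePoints (hP : IsFullPolytope P) :
    convexHull ℝ (P.extremePoints ℝ) = P := by
  have h1 := closure_convexHull_extremePoints hP.isCompact hP.convex
  have hfin : (P.extremePoints ℝ).Finite := by
    obtain ⟨⟨s, hs, rfl⟩, -⟩ := hP
    exact hs.subset extremePoints_convexHull_subset
  rwa [(hfin.isCompact_convexHull ℝ).isClosed.closure_eq] at h1

variable [FiniteDimensional ℝ E]

/-- Flatness in terms of the normalised facet functionals. -/
theorem isFlat_iff_facetFn (hP : IsFullPolytope P) (ho : o ∈ interior P) :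
    IsFlat P p ↔ (∀ F, 1 < facetFn o F (p F - o)) ∧ ∀ F G : Facet P, IsRidge P (F.1 ∩ G.1) →
      ∃ t : ℝ, 0 < t ∧ t < 1 ∧
        (1 - t) * facetFn o F (p F - o) + t * facetFn o G (p F - o) = 1 ∧
        (1 - t) * facetFn o F (p G - o) + t * facetFn o G (p G - o) = 1 := by
  constructor
  · intro hp
    refine ⟨one_lt_facetFn ho hp, fun F G hR => ?_⟩
    obtain ⟨t, h0, h1, ht⟩ := ridgeFn_eq_comb hP ho hp hR
    have hs := ridgeFn_spec ho hp hR
    have e1 := hs.2.2 F inter_subset_left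
    have e2 := hs.2.2 G inter_subset_right
    rw [ht, add_apply, smul_apply, smul_apply, smul_eq_mul, smul_eq_mul] at e1 e2
    exact ⟨t, h0, h1, e1, e2⟩
  · rintro ⟨h1, h2⟩
    refine ⟨fun F => (isBeyond_iff ho F).2 (h1 F), fun R hR => ?_⟩
    obtain ⟨F, G, rfl⟩ := exists_facets_inter_of_isRidge hP ho hR
    obtain ⟨t, ht0, ht1, e1, e2⟩ := h2 F G hR
    set k := (1 - t) • facetFn o F + t • facetFn o G with hk
    have hkP : k ∈ polarAt P o := polarAt_convex (facetFn_spec ho F).1 (facetFn_spec ho G).1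
      (by linarith) ht0.le (by ring)
    have hkR : ∀ x ∈ F.1 ∩ G.1, k (x - o) = 1 := by
      rintro x ⟨hx1, hx2⟩
      rw [hk, add_apply, smul_apply, smul_apply, facetFn_eq ho F hx1, facetFn_eq ho G hx2]
      simp
    refine ⟨k, 1 + k o, ?_, fun x hx => ?_, fun x hx => ?_, fun H hH => ?_⟩
    · intro h
      obtain ⟨x, hx⟩ := hR.2.1
      have := hkR x hx
      rw [h] at this
      simp at this
    · have := hkP x hx
      rw [map_sub] at this
      linarith
    · have := hkR x hx
      rw [map_sub] at this
      linarith
    · have : k (p H - o) = 1 := by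
        rw [hk, add_apply, smul_apply, smul_apply, smul_eq_mul, smul_eq_mul]
        rcases eq_or_eq_of_isRidge_inter hP ho hR hH with rfl | rfl
        · exact e1
        · exact e2
      rw [map_sub] at this
      linarith

/-- All inequalities but that of `F` hold at both ends of the segment, so it enters `P` exactly
where it crosses the hyperplane of `F`. -/
theorem lineMap_mem_iff (hP : IsFullPolytope P) (ho : o ∈ interior P) (F : Facet P) {v w : E}
    (hv : ∀ G : Facet P, G ≠ F → facetFn o G (v - o) < 1) (hvF : 1 < facetFn o F (v - o))
    (hw : w ∈ interior P) {t : ℝ} (ht : t ∈ Icc (0 : ℝ) 1) :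
    AffineMap.lineMap v w t ∈ P ↔
      (facetFn o F (v - o) - 1) / (facetFn o F (v - o) - facetFn o F (w - o)) ≤ t := by
  have hwF := (mem_interior_iff_facetFn_lt hP ho).1 hw F
  have hval : ∀ l : E →L[ℝ] ℝ,
      l (AffineMap.lineMap v w t - o) = (1 - t) * l (v - o) + t * l (w - o) := by
    intro l
    have : AffineMap.lineMap v w t - o = (1 - t) • (v - o) + t • (w - o) := by
      rw [AffineMap.lineMap_apply_module]
      module
    rw [this, map_add, map_smul, map_smul, smul_eq_mul, smul_eq_mul]
  have hd : 0 < facetFn o F (v - o) - facetFn o F (w - o) := by linarith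
  rw [mem_iff_facetFn_le hP ho, div_le_iff₀ hd]
  constructor
  · intro h
    have := h F
    rw [hval] at this
    linarith
  · intro h G
    rw [hval]
    by_cases hG : G = F
    · subst hG
      linarith
    · have e1 := mul_le_mul_of_nonneg_left (hv G hG).le (show 0 ≤ 1 - t by linarith [ht.2])
      have e2 := mul_le_mul_of_nonneg_left ((mem_interior_iff_facetFn_lt hP ho).1 hw G).le ht.1
      linarith

theorem fractionInside_eq (hP : IsFullPolytope P) (ho : o ∈ interior P) (F : Facet P) {v w : E}
    (hv : ∀ G : Facet P, G ≠ F → facetFn o G (v - o) < 1) (hvF : 1 < facetFn o F (v - o))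
    (hw : w ∈ interior P) :
    fractionInside P v w =
      (1 - facetFn o F (w - o)) / (facetFn o F (v - o) - facetFn o F (w - o)) := by
  have hwF := (mem_interior_iff_facetFn_lt hP ho).1 hw F
  have hd : 0 < facetFn o F (v - o) - facetFn o F (w - o) := by linarith
  set s := (facetFn o F (v - o) - 1) / (facetFn o F (v - o) - facetFn o F (w - o)) with hs
  have hs0 : 0 ≤ s := div_nonneg (by linarith) hd.le
  have hs1 : s ≤ 1 := (div_le_one hd).2 (by linarith)
  have : {t : ℝ | t ∈ Icc (0 : ℝ) 1 ∧ AffineMap.lineMap v w t ∈ P} = Icc s 1 := by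
    ext t
    constructor
    · rintro ⟨h1, h2⟩
      exact ⟨(lineMap_mem_iff hP ho F hv hvF hw h1).1 h2, h1.2⟩
    · rintro ⟨h1, h2⟩
      exact ⟨⟨hs0.trans h1, h2⟩, (lineMap_mem_iff hP ho F hv hvF hw ⟨hs0.trans h1, h2⟩).2 h1⟩
  rw [fractionInside, this, Real.volume_Icc, ENNReal.toReal_ofReal (by linarith), hs]
  field_simp
  ring

theorem fractionOutside_eq (hP : IsFullPolytope P) (ho : o ∈ interior P) (F : Facet P) {v w : E}
    (hv : ∀ G : Facet P, G ≠ F → facetFn o G (v - o) < 1) (hvF : 1 < facetFn o F (v - o))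
    (hw : w ∈ interior P) :
    fractionOutside P v w =
      (facetFn o F (v - o) - 1) / (facetFn o F (v - o) - facetFn o F (w - o)) := by
  have hwF := (mem_interior_iff_facetFn_lt hP ho).1 hw F
  have hd : 0 < facetFn o F (v - o) - facetFn o F (w - o) := by linarith
  set s := (facetFn o F (v - o) - 1) / (facetFn o F (v - o) - facetFn o F (w - o)) with hs
  have hs0 : 0 ≤ s := div_nonneg (by linarith) hd.le
  have hs1 : s ≤ 1 := (div_le_one hd).2 (by linarith)
  have : {t : ℝ | t ∈ Icc (0 : ℝ) 1 ∧ AffineMap.lineMap v w t ∉ P} = Ico 0 s := by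
    ext t
    constructor
    · rintro ⟨h1, h2⟩
      rw [lineMap_mem_iff hP ho F hv hvF hw h1, not_le] at h2
      exact ⟨h1.1, h2⟩
    · rintro ⟨h1, h2⟩
      have ht : t ∈ Icc (0 : ℝ) 1 := ⟨h1, h2.le.trans hs1⟩
      refine ⟨ht, ?_⟩
      rw [lineMap_mem_iff hP ho F hv hvF hw ht, not_le]
      exact h2
  rw [fractionOutside, this, Real.volume_Ico, ENNReal.toReal_ofReal (by linarith), sub_zero]

end Fractions

/-! ### Faces of products, and flat families on products -/

section Products

theorem mem_interior_prod {X Y : Type*} [TopologicalSpace X] [TopologicalSpace Y] {S : Set X}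
    {T : Set Y} {x : X} {y : Y} (hx : x ∈ interior S) (hy : y ∈ interior T) :
    (x, y) ∈ interior (S ×ˢ T) := by
  rw [interior_prod_eq]
  exact ⟨hx, hy⟩

variable {E₀ E₁ : Type*} [NormedAddCommGroup E₀] [NormedSpace ℝ E₀]
  [NormedAddCommGroup E₁] [NormedSpace ℝ E₁] {P₀ : Set E₀} {P₁ : Set E₁}

theorem IsFullPolytope.prod (h₀ : IsFullPolytope P₀) (h₁ : IsFullPolytope P₁) :
    IsFullPolytope (P₀ ×ˢ P₁) := by
  refine ⟨?_, ?_⟩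
  · obtain ⟨⟨s, hs, rfl⟩, -⟩ := h₀
    obtain ⟨⟨t, ht, rfl⟩, -⟩ := h₁
    exact ⟨s ×ˢ t, hs.prod ht, (convexHull_prod s t).symm⟩
  · rw [interior_prod_eq]
    exact h₀.2.prod h₁.2

theorem isExposed_prod {B₀ : Set E₀} {B₁ : Set E₁} (h₀ : IsExposed ℝ P₀ B₀)
    (h₁ : IsExposed ℝ P₁ B₁) : IsExposed ℝ (P₀ ×ˢ P₁) (B₀ ×ˢ B₁) := by
  rintro ⟨⟨a, b⟩, ha, hb⟩
  obtain ⟨l₀, e₀⟩ := h₀ ⟨a, ha⟩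
  obtain ⟨l₁, e₁⟩ := h₁ ⟨b, hb⟩
  have ha' : a ∈ P₀ ∧ ∀ y ∈ P₀, l₀ y ≤ l₀ a := by rw [e₀] at ha; exact ha
  have hb' : b ∈ P₁ ∧ ∀ y ∈ P₁, l₁ y ≤ l₁ b := by rw [e₁] at hb; exact hb
  refine ⟨l₀.comp (ContinuousLinearMap.fst ℝ E₀ E₁) + l₁.comp (ContinuousLinearMap.snd ℝ E₀ E₁), ?_⟩
  ext ⟨x, y⟩
  rw [e₀, e₁]
  constructor
  · rintro ⟨⟨hx, hx'⟩, hy, hy'⟩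
    exact ⟨⟨hx, hy⟩, fun z hz => add_le_add (hx' _ hz.1) (hy' _ hz.2)⟩
  · rintro ⟨⟨hx, hy⟩, h⟩
    have h1 : l₀ a + l₁ y ≤ l₀ x + l₁ y := h (a, y) ⟨ha'.1, hy⟩
    have h2 : l₀ x + l₁ b ≤ l₀ x + l₁ y := h (x, b) ⟨hx, hb'.1⟩
    exact ⟨⟨hx, fun z hz => (ha'.2 z hz).trans (by linarith)⟩,
      hy, fun z hz => (hb'.2 z hz).trans (by linarith)⟩

/-- A functional on the product is a sum of functionals on the factors, and a sum is maximal exactly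
when both summands are. -/
theorem exists_eq_prod_of_isExposed {B : Set (E₀ × E₁)} (hB : IsExposed ℝ (P₀ ×ˢ P₁) B)
    (hne : B.Nonempty) : ∃ (B₀ : Set E₀) (B₁ : Set E₁), IsExposed ℝ P₀ B₀ ∧ IsExposed ℝ P₁ B₁ ∧
      B₀.Nonempty ∧ B₁.Nonempty ∧ B = B₀ ×ˢ B₁ := by
  obtain ⟨l, hl⟩ := hB hne
  let l₀ : StrongDual ℝ E₀ := l.comp (ContinuousLinearMap.inl ℝ E₀ E₁)
  let l₁ : StrongDual ℝ E₁ := l.comp (ContinuousLinearMap.inr ℝ E₀ E₁)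
  have hsum : ∀ x y, l (x, y) = l₀ x + l₁ y := by
    intro x y
    simp only [l₀, l₁, ContinuousLinearMap.comp_apply, ContinuousLinearMap.inl_apply,
      ContinuousLinearMap.inr_apply, ← map_add, Prod.mk_add_mk, add_zero, zero_add]
  have heq : B = l₀.toExposed P₀ ×ˢ l₁.toExposed P₁ := by
    rw [hl]
    ext ⟨x, y⟩
    constructor
    · rintro ⟨⟨hx, hy⟩, h⟩
      refine ⟨⟨hx, fun z hz => ?_⟩, hy, fun z hz => ?_⟩
      · have := h (z, y) ⟨hz, hy⟩
        rw [hsum, hsum] at this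
        linarith
      · have := h (x, z) ⟨hx, hz⟩
        rw [hsum, hsum] at this
        linarith
    · rintro ⟨⟨hx, hx'⟩, hy, hy'⟩
      refine ⟨⟨hx, hy⟩, ?_⟩
      rintro ⟨z, w⟩ ⟨hz, hw⟩
      rw [hsum, hsum]
      exact add_le_add (hx' z hz) (hy' w hw)
  have hne' := hne
  rw [heq, prod_nonempty_iff] at hne'
  exact ⟨_, _, ContinuousLinearMap.toExposed.isExposed, ContinuousLinearMap.toExposed.isExposed,
    hne'.1, hne'.2, heq⟩

theorem dim_prod [FiniteDimensional ℝ E₀] [FiniteDimensional ℝ E₁] {B₀ : Set E₀} {B₁ : Set E₁}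
    (h₀ : B₀.Nonempty) (h₁ : B₁.Nonempty) : dim (B₀ ×ˢ B₁) = dim B₀ + dim B₁ := by
  rw [dim, vectorSpan_prod_eq h₀ h₁, dim, dim, ← Module.finrank_prod]
  exact LinearEquiv.finrank_eq
    { toFun := fun x => (⟨x.1.1, x.2.1⟩, ⟨x.1.2, x.2.2⟩)
      invFun := fun x => ⟨(x.1.1, x.2.1), x.1.2, x.2.2⟩
      map_add' := fun _ _ => rfl
      map_smul' := fun _ _ => rfl
      left_inv := fun _ => rfl
      right_inv := fun _ => rfl }

theorem dim_lt_of_isExposed {E : Type*} [NormedAddCommGroup E] [NormedSpace ℝ E]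
    [FiniteDimensional ℝ E] {P B : Set E} (hP : (interior P).Nonempty) (hB : IsExposed ℝ P B)
    (hne : B.Nonempty) (hBP : B ≠ P) : dim B + 1 ≤ dim P := by
  obtain ⟨o, ho⟩ := hP
  obtain ⟨k, hk, rfl⟩ := exists_touch_of_isExposed ho hB hne hBP
  rw [← finrank_relSpan hne (fun x hx => hx.2), dim_eq_finrank ⟨o, ho⟩]
  exact Submodule.finrank_le _

theorem IsFullPolytope.nonempty {E : Type*} [NormedAddCommGroup E] [NormedSpace ℝ E] {P : Set E}
    (h : IsFullPolytope P) : P.Nonempty := h.2.mono interior_subset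

theorem convexHull_extremePoints_prod_union (h₀ : IsFullPolytope P₀) (h₁ : IsFullPolytope P₁)
    (X : Set (E₀ × E₁)) :
    convexHull ℝ (P₀.extremePoints ℝ ×ˢ P₁.extremePoints ℝ ∪ X) = convexHull ℝ (P₀ ×ˢ P₁ ∪ X) := by
  rw [← convexHull_convexHull_union_left, convexHull_prod, h₀.convexHull_extremePoints,
    h₁.convexHull_extremePoints]

variable [FiniteDimensional ℝ E₀] [FiniteDimensional ℝ E₁]

/-- The facet `F × P₁` of a product. -/
def facetLeft (h₀ : IsFullPolytope P₀) (h₁ : IsFullPolytope P₁) (F : Facet P₀) :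
    Facet (P₀ ×ˢ P₁) :=
  ⟨F.1 ×ˢ P₁, isExposed_prod F.2.1 (IsExposed.refl P₁), F.2.2.1.prod h₁.nonempty, by
    rw [dim_prod F.2.2.1 h₁.nonempty, dim_prod h₀.nonempty h₁.nonempty]
    have := F.2.2.2
    omega⟩

/-- The facet `P₀ × G` of a product. -/
def facetRight (h₀ : IsFullPolytope P₀) (h₁ : IsFullPolytope P₁) (G : Facet P₁) :
    Facet (P₀ ×ˢ P₁) :=
  ⟨P₀ ×ˢ G.1, isExposed_prod (IsExposed.refl P₀) G.2.1, h₀.nonempty.prod G.2.2.1, by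
    rw [dim_prod h₀.nonempty G.2.2.1, dim_prod h₀.nonempty h₁.nonempty]
    have := G.2.2.2
    omega⟩

/-- Codimensions add over the factors, so a facet is proper in exactly one of them. -/
theorem bijective_sum_elim_facet (h₀ : IsFullPolytope P₀) (h₁ : IsFullPolytope P₁) :
    Function.Bijective (Sum.elim (facetLeft h₀ h₁) (facetRight h₀ h₁)) := by
  constructor
  · rintro (F | F) (G | G) h
    · have h' : F.1 ×ˢ P₁ = G.1 ×ˢ P₁ := congrArg Subtype.val h
      rw [prod_eq_prod_iff_of_nonempty (F.2.2.1.prod h₁.nonempty)] at h'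
      rw [Subtype.ext h'.1]
    · have h' : F.1 ×ˢ P₁ = P₀ ×ˢ G.1 := congrArg Subtype.val h
      rw [prod_eq_prod_iff_of_nonempty (F.2.2.1.prod h₁.nonempty)] at h'
      exact absurd h'.1 (facet_ne F)
    · have h' : P₀ ×ˢ F.1 = G.1 ×ˢ P₁ := congrArg Subtype.val h
      rw [prod_eq_prod_iff_of_nonempty (h₀.nonempty.prod F.2.2.1)] at h'
      exact absurd h'.2 (facet_ne F)
    · have h' : P₀ ×ˢ F.1 = P₀ ×ˢ G.1 := congrArg Subtype.val h
      rw [prod_eq_prod_iff_of_nonempty (h₀.nonempty.prod F.2.2.1)] at h'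
      rw [Subtype.ext h'.2]
  · rintro ⟨B, hB, hne, hdim⟩
    obtain ⟨B₀, B₁, e₀, e₁, n₀, n₁, rfl⟩ := exists_eq_prod_of_isExposed hB hne
    rw [dim_prod n₀ n₁, dim_prod h₀.nonempty h₁.nonempty] at hdim
    by_cases c₀ : B₀ = P₀
    · subst c₀
      exact ⟨Sum.inr ⟨B₁, e₁, n₁, by omega⟩, rfl⟩
    · have := dim_lt_of_isExposed h₀.2 e₀ n₀ c₀
      by_cases c₁ : B₁ = P₁
      · subst c₁
        exact ⟨Sum.inl ⟨B₀, e₀, n₀, by omega⟩, rfl⟩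
      · have := dim_lt_of_isExposed h₁.2 e₁ n₁ c₁
        omega

/-- The facets of a product of polytopes. -/
def facetSumEquiv (h₀ : IsFullPolytope P₀) (h₁ : IsFullPolytope P₁) :
    Facet P₀ ⊕ Facet P₁ ≃ Facet (P₀ ×ˢ P₁) :=
  Equiv.ofBijective _ (bijective_sum_elim_facet h₀ h₁)

variable {o₀ : E₀} {o₁ : E₁}

theorem facetFn_facetLeft (h₀ : IsFullPolytope P₀) (h₁ : IsFullPolytope P₁)
    (ho₀ : o₀ ∈ interior P₀) (ho₁ : o₁ ∈ interior P₁) (F : Facet P₀) (x : E₀ × E₁) :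
    facetFn (o₀, o₁) (facetLeft h₀ h₁ F) (x - (o₀, o₁)) = facetFn o₀ F (x.1 - o₀) := by
  rw [← eq_facetFn (k := (facetFn o₀ F).comp (ContinuousLinearMap.fst ℝ E₀ E₁))
    (mem_interior_prod ho₀ ho₁) (facetLeft h₀ h₁ F) fun y hy => facetFn_eq ho₀ F hy.1]
  rfl

theorem facetFn_facetRight (h₀ : IsFullPolytope P₀) (h₁ : IsFullPolytope P₁)
    (ho₀ : o₀ ∈ interior P₀) (ho₁ : o₁ ∈ interior P₁) (G : Facet P₁) (x : E₀ × E₁) :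
    facetFn (o₀, o₁) (facetRight h₀ h₁ G) (x - (o₀, o₁)) = facetFn o₁ G (x.2 - o₁) := by
  rw [← eq_facetFn (k := (facetFn o₁ G).comp (ContinuousLinearMap.snd ℝ E₀ E₁))
    (mem_interior_prod ho₀ ho₁) (facetRight h₀ h₁ G) fun y hy => facetFn_eq ho₁ G hy.2]
  rfl

theorem isRidge_facetLeft_inter (h₀ : IsFullPolytope P₀) (h₁ : IsFullPolytope P₁)
    (F G : Facet P₀) : IsRidge (P₀ ×ˢ P₁) ((facetLeft h₀ h₁ F).1 ∩ (facetLeft h₀ h₁ G).1) ↔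
      IsRidge P₀ (F.1 ∩ G.1) := by
  have e : (facetLeft h₀ h₁ F).1 ∩ (facetLeft h₀ h₁ G).1 = (F.1 ∩ G.1) ×ˢ P₁ := by
    simp only [facetLeft, inter_prod]
  rw [e]
  constructor
  · rintro ⟨-, hne, hd⟩
    have hne' := (prod_nonempty_iff.1 hne).1
    rw [dim_prod hne' h₁.nonempty, dim_prod h₀.nonempty h₁.nonempty] at hd
    exact ⟨F.2.1.inter G.2.1, hne', by omega⟩
  · rintro ⟨hexp, hne, hd⟩
    refine ⟨isExposed_prod hexp (IsExposed.refl P₁), hne.prod h₁.nonempty, ?_⟩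
    rw [dim_prod hne h₁.nonempty, dim_prod h₀.nonempty h₁.nonempty]
    omega

theorem isRidge_facetRight_inter (h₀ : IsFullPolytope P₀) (h₁ : IsFullPolytope P₁)
    (F G : Facet P₁) : IsRidge (P₀ ×ˢ P₁) ((facetRight h₀ h₁ F).1 ∩ (facetRight h₀ h₁ G).1) ↔
      IsRidge P₁ (F.1 ∩ G.1) := by
  have e : (facetRight h₀ h₁ F).1 ∩ (facetRight h₀ h₁ G).1 = P₀ ×ˢ (F.1 ∩ G.1) := by
    simp only [facetRight, prod_inter]
  rw [e]
  constructor
  · rintro ⟨-, hne, hd⟩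
    have hne' := (prod_nonempty_iff.1 hne).2
    rw [dim_prod h₀.nonempty hne', dim_prod h₀.nonempty h₁.nonempty] at hd
    exact ⟨F.2.1.inter G.2.1, hne', by omega⟩
  · rintro ⟨hexp, hne, hd⟩
    refine ⟨isExposed_prod (IsExposed.refl P₀) hexp, h₀.nonempty.prod hne, ?_⟩
    rw [dim_prod h₀.nonempty hne, dim_prod h₀.nonempty h₁.nonempty]
    omega

theorem isRidge_facetLeft_inter_facetRight (h₀ : IsFullPolytope P₀) (h₁ : IsFullPolytope P₁)
    (F : Facet P₀) (G : Facet P₁) :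
    IsRidge (P₀ ×ˢ P₁) ((facetLeft h₀ h₁ F).1 ∩ (facetRight h₀ h₁ G).1) := by
  have e : (facetLeft h₀ h₁ F).1 ∩ (facetRight h₀ h₁ G).1 = F.1 ×ˢ G.1 := by
    simp only [facetLeft, facetRight, prod_inter_prod, inter_eq_left.2 F.2.1.subset,
      inter_eq_right.2 G.2.1.subset]
  rw [e]
  refine ⟨isExposed_prod F.2.1 G.2.1, F.2.2.1.prod G.2.2.1, ?_⟩
  rw [dim_prod F.2.2.1 G.2.2.1, dim_prod h₀.nonempty h₁.nonempty]
  have := F.2.2.2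
  have := G.2.2.2
  omega

/-- Here `x`, `y` are the values of two facet functionals at one new point and `z`, `w` those at the
other. Eliminating `t` leaves `(x - 1) * (w - 1) = (1 - y) * (1 - z)`, which is the equality of
quotients after clearing denominators. -/
theorem exists_comb_iff {x y z w : ℝ} (hx : 1 < x) (hw : 1 < w) :
    (∃ t : ℝ, 0 < t ∧ t < 1 ∧ (1 - t) * x + t * y = 1 ∧ (1 - t) * z + t * w = 1) ↔
      y < 1 ∧ z < 1 ∧ (x - 1) / (x - z) = (1 - y) / (w - y) := by
  constructor
  · rintro ⟨t, h0, h1, e1, e2⟩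
    have hy : y < 1 := by
      by_contra! h
      have := mul_le_mul_of_nonneg_left h h0.le
      have := mul_lt_mul_of_pos_left hx (show 0 < 1 - t by linarith)
      linarith
    have hz : z < 1 := by
      by_contra! h
      have := mul_lt_mul_of_pos_left hw h0
      have := mul_le_mul_of_nonneg_left h (show 0 ≤ 1 - t by linarith)
      linarith
    refine ⟨hy, hz, ?_⟩
    rw [div_eq_div_iff (by linarith) (by linarith)]
    have hp : 0 < t * (1 - t) := mul_pos h0 (by linarith)
    have f1 : (1 - t) * (x - 1) = t * (1 - y) := by linarith
    have f2 : t * (w - 1) = (1 - t) * (1 - z) := by linarith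
    have f3 : t * (1 - t) * ((x - 1) * (w - 1)) = t * (1 - t) * ((1 - y) * (1 - z)) := by
      calc t * (1 - t) * ((x - 1) * (w - 1)) = ((1 - t) * (x - 1)) * (t * (w - 1)) := by ring
        _ = (t * (1 - y)) * ((1 - t) * (1 - z)) := by rw [f1, f2]
        _ = t * (1 - t) * ((1 - y) * (1 - z)) := by ring
    have := mul_left_cancel₀ hp.ne' f3
    linarith
  · rintro ⟨hy, hz, h⟩
    rw [div_eq_div_iff (by linarith) (by linarith)] at h
    have hd : 0 < x - y := by linarith
    refine ⟨(x - 1) / (x - y), div_pos (by linarith) hd, (div_lt_one hd).2 (by linarith), ?_, ?_⟩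
    · field_simp
      ring
    · field_simp
      linarith

/-- Flat families on a product correspond to flat families on the factors whose complementary
coordinates satisfy the ratio condition. -/
theorem isFlat_prod_iff (h₀ : IsFullPolytope P₀) (h₁ : IsFullPolytope P₁)
    {q : Facet (P₀ ×ˢ P₁) → E₀ × E₁} :
    IsFlat (P₀ ×ˢ P₁) q ↔
      IsFlat P₀ (fun F => (q (facetLeft h₀ h₁ F)).1) ∧
      IsFlat P₁ (fun G => (q (facetRight h₀ h₁ G)).2) ∧
      (∀ F, (q (facetLeft h₀ h₁ F)).2 ∈ interior P₁) ∧
      (∀ G, (q (facetRight h₀ h₁ G)).1 ∈ interior P₀) ∧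
      ∀ F G, fractionOutside P₀ (q (facetLeft h₀ h₁ F)).1 (q (facetRight h₀ h₁ G)).1 =
          fractionInside P₁ (q (facetRight h₀ h₁ G)).2 (q (facetLeft h₀ h₁ F)).2 := by
  obtain ⟨o₀, ho₀⟩ := h₀.2
  obtain ⟨o₁, ho₁⟩ := h₁.2
  have hL := facetFn_facetLeft h₀ h₁ ho₀ ho₁
  have hR := facetFn_facetRight h₀ h₁ ho₀ ho₁
  constructor
  · intro hq
    rw [isFlat_iff_facetFn (h₀.prod h₁) (mem_interior_prod ho₀ ho₁)] at hq
    obtain ⟨hb, hr⟩ := hq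
    have hbL : ∀ F, 1 < facetFn o₀ F ((q (facetLeft h₀ h₁ F)).1 - o₀) := fun F =>
      hL F _ ▸ hb (facetLeft h₀ h₁ F)
    have hbR : ∀ G, 1 < facetFn o₁ G ((q (facetRight h₀ h₁ G)).2 - o₁) := fun G =>
      hR G _ ▸ hb (facetRight h₀ h₁ G)
    have f₀ : IsFlat P₀ (fun F => (q (facetLeft h₀ h₁ F)).1) := by
      refine (isFlat_iff_facetFn h₀ ho₀).2 ⟨hbL, fun F G hFG => ?_⟩
      have := hr _ _ ((isRidge_facetLeft_inter h₀ h₁ F G).2 hFG)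
      simpa only [hL] using this
    have f₁ : IsFlat P₁ (fun G => (q (facetRight h₀ h₁ G)).2) := by
      refine (isFlat_iff_facetFn h₁ ho₁).2 ⟨hbR, fun F G hFG => ?_⟩
      have := hr _ _ ((isRidge_facetRight_inter h₀ h₁ F G).2 hFG)
      simpa only [hR] using this
    -- The mixed ridge `F × G` yields at once that the complementary coordinates are beneath `G` and
    -- `F` and that the quotients agree.
    have hcross : ∀ F G, _ := fun F G => by
      have := hr _ _ (isRidge_facetLeft_inter_facetRight h₀ h₁ F G)
      simp only [hL, hR] at this
      exact (exists_comb_iff (hbL F) (hbR G)).1 this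
    have i₀ : ∀ F, (q (facetLeft h₀ h₁ F)).2 ∈ interior P₁ := fun F =>
      (mem_interior_iff_facetFn_lt h₁ ho₁).2 fun G => (hcross F G).1
    have i₁ : ∀ G, (q (facetRight h₀ h₁ G)).1 ∈ interior P₀ := fun G =>
      (mem_interior_iff_facetFn_lt h₀ ho₀).2 fun F => (hcross F G).2.1
    refine ⟨f₀, f₁, i₀, i₁, fun F G => ?_⟩
    rw [fractionOutside_eq h₀ ho₀ F (fun G hG => facetFn_lt_one_of_ne h₀ ho₀ f₀ hG) (hbL F) (i₁ G),
      fractionInside_eq h₁ ho₁ G (fun F hF => facetFn_lt_one_of_ne h₁ ho₁ f₁ hF) (hbR G) (i₀ F)]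
    exact (hcross F G).2.2
  · rintro ⟨f₀, f₁, i₀, i₁, hratio⟩
    have hbL := one_lt_facetFn ho₀ f₀
    have hbR := one_lt_facetFn ho₁ f₁
    have hcross : ∀ F G, _ := fun F G => by
      have := hratio F G
      rw [fractionOutside_eq h₀ ho₀ F (fun G hG => facetFn_lt_one_of_ne h₀ ho₀ f₀ hG) (hbL F) (i₁ G),
        fractionInside_eq h₁ ho₁ G (fun F hF => facetFn_lt_one_of_ne h₁ ho₁ f₁ hF) (hbR G) (i₀ F)]
        at this
      exact (exists_comb_iff (hbL F) (hbR G)).2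
        ⟨(mem_interior_iff_facetFn_lt h₁ ho₁).1 (i₀ F) G,
          (mem_interior_iff_facetFn_lt h₀ ho₀).1 (i₁ G) F, this⟩
    have hsurj := (bijective_sum_elim_facet h₀ h₁).2
    refine (isFlat_iff_facetFn (h₀.prod h₁) (mem_interior_prod ho₀ ho₁)).2
      ⟨fun F => ?_, fun F G hFG => ?_⟩
    · obtain ⟨F | F, rfl⟩ := hsurj F
      · simpa only [Sum.elim_inl, hL] using hbL F
      · simpa only [Sum.elim_inr, hR] using hbR F
    · obtain ⟨F | F, rfl⟩ := hsurj F <;> obtain ⟨G | G, rfl⟩ := hsurj G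
      · simpa only [Sum.elim_inl, hL] using ((isFlat_iff_facetFn h₀ ho₀).1 f₀).2 F G
          ((isRidge_facetLeft_inter h₀ h₁ F G).1 hFG)
      · simpa only [Sum.elim_inl, Sum.elim_inr, hL, hR] using hcross F G
      · obtain ⟨t, t0, t1, e1, e2⟩ := hcross G F
        simp only [Sum.elim_inl, Sum.elim_inr, hL, hR]
        exact ⟨1 - t, by linarith, by linarith, by linarith, by linarith⟩
      · simpa only [Sum.elim_inr, hR] using ((isFlat_iff_facetFn h₁ ho₁).1 f₁).2 F G
          ((isRidge_facetRight_inter h₀ h₁ F G).1 hFG)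

/-- Realisations of the factors and maps satisfying the ratio condition yield a realisation of the
product. -/
theorem isVertexPreservingRealisation_prod (h₀ : IsFullPolytope P₀) (h₁ : IsFullPolytope P₁)
    {Q₀ : Set E₀} {Q₁ : Set E₁} {β₀ : newVertices P₀ Q₀ → interior P₁}
    {β₁ : newVertices P₁ Q₁ → interior P₀} (hQ₀ : IsVertexPreservingRealisation P₀ Q₀)
    (hQ₁ : IsVertexPreservingRealisation P₁ Q₁) (hβ : RatioCondition P₀ Q₀ P₁ Q₁ β₀ β₁) :
    IsVertexPreservingRealisation (P₀ ×ˢ P₁)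
      (convexHull ℝ (productPoints P₀ Q₀ P₁ Q₁ β₀ β₁)) := by
  obtain ⟨p₀, f₀, rfl⟩ := (isVertexPreservingRealisation_iff h₀).1 hQ₀
  obtain ⟨p₁, f₁, rfl⟩ := (isVertexPreservingRealisation_iff h₁).1 hQ₁
  have n₀ := newVertices_eq h₀ f₀
  have n₁ := newVertices_eq h₁ f₁
  -- The maps `β₀`, `β₁` are indexed by new vertices and flat families by facets; `w₀` and `w₁`
  -- translate, and their surjectivity ensures that no point of `productPoints` is missed.
  let w₀ : Facet P₀ → newVertices P₀ (convexHull ℝ (P₀ ∪ range p₀)) :=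
    fun F => ⟨p₀ F, n₀.ge (mem_range_self F)⟩
  let w₁ : Facet P₁ → newVertices P₁ (convexHull ℝ (P₁ ∪ range p₁)) :=
    fun G => ⟨p₁ G, n₁.ge (mem_range_self G)⟩
  have s₀ : Function.Surjective w₀ := by
    rintro ⟨v, hv⟩
    obtain ⟨F, rfl⟩ := n₀.le hv
    exact ⟨F, rfl⟩
  have s₁ : Function.Surjective w₁ := by
    rintro ⟨v, hv⟩
    obtain ⟨F, rfl⟩ := n₁.le hv
    exact ⟨F, rfl⟩
  let r : Facet P₀ ⊕ Facet P₁ → E₀ × E₁ :=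
    Sum.elim (fun F => (p₀ F, (β₀ (w₀ F) : E₁))) (fun G => ((β₁ (w₁ G) : E₀), p₁ G))
  let q : Facet (P₀ ×ˢ P₁) → E₀ × E₁ := r ∘ (facetSumEquiv h₀ h₁).symm
  have qL : ∀ F, q (facetLeft h₀ h₁ F) = (p₀ F, (β₀ (w₀ F) : E₁)) := fun F =>
    congrArg r ((facetSumEquiv h₀ h₁).symm_apply_apply (Sum.inl F))
  have qR : ∀ G, q (facetRight h₀ h₁ G) = ((β₁ (w₁ G) : E₀), p₁ G) := fun G =>
    congrArg r ((facetSumEquiv h₀ h₁).symm_apply_apply (Sum.inr G))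
  refine (isVertexPreservingRealisation_iff (h₀.prod h₁)).2 ⟨q, ?_, ?_⟩
  · rw [isFlat_prod_iff h₀ h₁]
    simp only [qL, qR]
    exact ⟨f₀, f₁, fun F => (β₀ (w₀ F)).2, fun G => (β₁ (w₁ G)).2, fun F G => hβ (w₀ F) (w₁ G)⟩
  · rw [← convexHull_extremePoints_prod_union h₀ h₁, productPoints, union_assoc]
    congr 2
    have : range q = range r := (facetSumEquiv h₀ h₁).symm.surjective.range_comp r
    rw [this, Sum.elim_range, ← s₀.range_comp, ← s₁.range_comp]
    rfl

/-- A realisation of the product induces realisations of the factors and maps satisfying the ratio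
condition. -/
theorem exists_of_isVertexPreservingRealisation_prod (h₀ : IsFullPolytope P₀)
    (h₁ : IsFullPolytope P₁) {Q : Set (E₀ × E₁)}
    (hQ : IsVertexPreservingRealisation (P₀ ×ˢ P₁) Q) :
    ∃ (Q₀ : Set E₀) (Q₁ : Set E₁), IsVertexPreservingRealisation P₀ Q₀ ∧
      IsVertexPreservingRealisation P₁ Q₁ ∧ ∃ (β₀ : newVertices P₀ Q₀ → interior P₁)
        (β₁ : newVertices P₁ Q₁ → interior P₀), RatioCondition P₀ Q₀ P₁ Q₁ β₀ β₁ := by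
  obtain ⟨q, hq, -⟩ := (isVertexPreservingRealisation_iff (h₀.prod h₁)).1 hQ
  obtain ⟨f₀, f₁, i₀, i₁, hratio⟩ := (isFlat_prod_iff h₀ h₁).1 hq
  refine ⟨_, _, (isVertexPreservingRealisation_iff h₀).2 ⟨_, f₀, rfl⟩,
    (isVertexPreservingRealisation_iff h₁).2 ⟨_, f₁, rfl⟩, ?_⟩
  have c₀ : ∀ v : newVertices P₀ _, ∃ F, (q (facetLeft h₀ h₁ F)).1 = v := fun v =>
    (newVertices_eq h₀ f₀).le v.2
  have c₁ : ∀ v : newVertices P₁ _, ∃ G, (q (facetRight h₀ h₁ G)).2 = v := fun v =>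
    (newVertices_eq h₁ f₁).le v.2
  -- Each new vertex receives a facet beyond which it was placed; the complementary coordinate of
  -- the product point at that facet defines `β₀` and, likewise, `β₁`.
  choose F hF using c₀
  choose G hG using c₁
  refine ⟨fun v => ⟨_, i₀ (F v)⟩, fun v => ⟨_, i₁ (G v)⟩, fun v₀ v₁ => ?_⟩
  have := hratio (F v₀) (G v₁)
  rwa [hF, hG] at this

end Products

end EConstruction

end

theorem theorem2p1 (d₀ d₁ : ℕ)
    (P₀ : Set (EuclideanSpace ℝ (Fin d₀))) (P₁ : Set (EuclideanSpace ℝ (Fin d₁)))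
    (hP₀ : EConstruction.IsFullPolytope P₀) (hP₁ : EConstruction.IsFullPolytope P₁)
    (hdim : 3 ≤ EConstruction.dim (P₀ ×ˢ P₁)) :
    (∀ (Q₀ : Set (EuclideanSpace ℝ (Fin d₀))) (Q₁ : Set (EuclideanSpace ℝ (Fin d₁)))
        (β₀ : EConstruction.newVertices P₀ Q₀ → interior P₁)
        (β₁ : EConstruction.newVertices P₁ Q₁ → interior P₀),
      EConstruction.IsVertexPreservingRealisation P₀ Q₀ →
      EConstruction.IsVertexPreservingRealisation P₁ Q₁ →
      EConstruction.RatioCondition P₀ Q₀ P₁ Q₁ β₀ β₁ →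
      EConstruction.IsVertexPreservingRealisation (P₀ ×ˢ P₁)
        (convexHull ℝ (EConstruction.productPoints P₀ Q₀ P₁ Q₁ β₀ β₁))) ∧
    ((∃ Q : Set (EuclideanSpace ℝ (Fin d₀) × EuclideanSpace ℝ (Fin d₁)),
        EConstruction.IsVertexPreservingRealisation (P₀ ×ˢ P₁) Q) ↔
      ∃ (Q₀ : Set (EuclideanSpace ℝ (Fin d₀))) (Q₁ : Set (EuclideanSpace ℝ (Fin d₁))),
        EConstruction.IsVertexPreservingRealisation P₀ Q₀ ∧
        EConstruction.IsVertexPreservingRealisation P₁ Q₁ ∧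
        ∃ (β₀ : EConstruction.newVertices P₀ Q₀ → interior P₁)
          (β₁ : EConstruction.newVertices P₁ Q₁ → interior P₀),
          EConstruction.RatioCondition P₀ Q₀ P₁ Q₁ β₀ β₁) := by
  refine ⟨fun Q₀ Q₁ β₀ β₁ hQ₀ hQ₁ hβ =>
    EConstruction.isVertexPreservingRealisation_prod hP₀ hP₁ hQ₀ hQ₁ hβ, ?_, ?_⟩
  · rintro ⟨Q, hQ⟩
    exact EConstruction.exists_of_isVertexPreservingRealisation_prod hP₀ hP₁ hQ
  · rintro ⟨Q₀, Q₁, hQ₀, hQ₁, β₀, β₁, hβ⟩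
    exact ⟨_, EConstruction.isVertexPreservingRealisation_prod hP₀ hP₁ hQ₀ hQ₁ hβ⟩
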